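/- Let $d\in\mathbb N$, $\mathbb T^d=(\mathbb R/2\pi\mathbb Z)^d$, let $H\in C^\infty(\mathbb R^d;\mathbb R)$, and for $h>0$ let $S_h^t=e^{-i\frac th H(hD_x)}$ on $L^2(\mathbb T^d)$. For $u\in L^2(\mathbb T^d)$ let $w^h_u$ be its Wigner distribution, $\langle w_u^h,a\rangle=\langle u,\mathrm{Op}_h(a)u\rangle_{L^2(\mathbb T^d)}$ for $a\in C_c^\infty(T^*\mathbb T^d)$, where $\mathrm{Op}_h$ is the Weyl quantization and $T^*\mathbb T^d=\mathbb T^d\times\mathbb R^d$. Given $\tau:(0,\infty)\to(0,\infty)$, $h\mapsto\tau_h$, say that $\mu\in L^\infty(\mathbb R;\mathcal M_+(T^*\mathbb T^d))$ (with $\mathcal M_+$ the positive Radon measures) is obtained at time scale $\tau$ through a sequence $h_n\to0^+$ and normalised $u_n\in L^2(\mathbb T^d)$, $\|u_n\|=1$, if $$\int_{\mathbb R}\theta(t)\,\big\langle w^{h_n}_{S_{h_n}^{\tau_{h_n}t}u_n},a\big\rangle\,dt\longrightarrow\int_{\mathbb R}\theta(t)\int_{T^*\mathbb T^d}a(x,\xi)\,\mu(t,dx,d\xi)\,dt\qquad(n\to\infty)$$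 for all $\theta\in L^1(\mathbb R)$ and $a\in C_c^\infty(T^*\mathbb T^d)$; the set of all such $\mu$ is $\widetilde{\mathcal M}(\tau)$. A semiclassical measure of $(u_n)$ is an accumulation point $\mu_0\in\mathcal M_+(T^*\mathbb T^d)$, along a subsequence, of $(w^{h_n}_{u_n})$ in $\mathcal D'(T^*\mathbb T^d)$. Let $\widetilde{\mathcal M}(\infty)$ be the set of all semiclassical measures of sequences $(u_n)$ (with $h_n\to0^+$) in which each $u_n$ is a normalised eigenfunction of $H(h_nD_x)$; its elements are viewed as elements of $L^\infty(\mathbb R;\mathcal M_+(T^*\mathbb T^d))$ that are constant in $t$. For $O\subseteq\mathbb R^d$ put $$\tau_h^H(O)=h\,\sup\big\{|H(hk)-H(hj)|^{-1}:\ k,j\in\mathbb Z^d,\ hk,hj\in O,\ H(hk)\ne H(hj)\big\}\in[0,\infty],\qquad \sup\emptyset=0.$$ Let $O\subseteq\mathbb R^d$ be open with $\tau_h^H(O)\to\infty$ as $h\to0^+$, and let $\tau$ satisfy $\tau_h^H(O)/\tau_h\to0$ as $h\to0^+$. If $\mu\in\widetilde{\mathcal M}(\tau)$ is obtained through a sequence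 having a semiclassical measure $\mu_0$ with $\mu_0(\mathbb T^d\times(\mathbb R^d\setminus O))=0$, then $\mu$ belongs to the closed convex hull $\overline{\operatorname{Conv}\,\widetilde{\mathcal M}(\infty)}$, the closure being taken in the weak-$*$ topology, that is, the topology of convergence of $\int_{\mathbb R}\theta(t)\int_{T^*\mathbb T^d}a\,d\mu(t,\cdot)\,dt$ for all $\theta\in L^1(\mathbb R)$ and $a\in C_c^\infty(T^*\mathbb T^d)$. -/

import Mathlib

open MeasureTheory ProbabilityTheory Filter Topology
open scoped ContDiff

noncomputable section

namespace TorusFlow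

/-- `2π > 0`, so that `ℝ / 2πℤ` carries its Lebesgue measure (of total mass `2π`). -/
instance factTwoPiPos : Fact (0 < 2 * Real.pi) := ⟨Real.two_pi_pos⟩

/-- The torus `𝕋^d = (ℝ / 2πℤ)^d`. -/
abbrev Torus (d : ℕ) : Type := Fin d → AddCircle (2 * Real.pi)

/-- The frequency space `(ℝ^d)^*`, identified with `ℝ^d` in the canonical basis. -/
abbrev Freq (d : ℕ) : Type := EuclideanSpace ℝ (Fin d)

/-- The cotangent bundle `T^*𝕋^d = 𝕋^d × ℝ^d`. -/
abbrev Cotangent (d : ℕ) : Type := Torus d × Freq d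

/-- `L²(𝕋^d)` with respect to the Lebesgue measure `dx` (of total mass `(2π)^d`). -/
abbrev L2 (d : ℕ) : Type := Lp ℂ 2 (volume : Measure (Torus d))

/-! ### The Fourier basis of `L²(𝕋^d)` -/

/-- The character `x ↦ e^{i k·x}` of the torus. -/
def character {d : ℕ} (k : Fin d → ℤ) : C(Torus d, ℂ) where
  toFun x := ∏ i : Fin d, fourier (k i) (x i)
  continuous_toFun := by fun_prop

/-- The normalised exponential `e_k(x) = (2π)^{-d/2} e^{i k·x}`, as an element of `L²(𝕋^d)`. -/
def expo {d : ℕ} (k : Fin d → ℤ) : L2 d :=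
  ContinuousMap.toLp (E := ℂ) 2 (volume : Measure (Torus d)) ℂ
    ((((2 * Real.pi) ^ (-(d : ℝ) / 2) : ℝ) : ℂ) • character k)

theorem character_neg {d : ℕ} (k : Fin d → ℤ) (x : Torus d) :
    character (-k) x = (starRingEnd ℂ) (character k x) := by
  simp only [character, Pi.neg_apply, fourier_neg, ContinuousMap.coe_mk, map_prod]

theorem character_add {d : ℕ} (k j : Fin d → ℤ) (x : Torus d) :
    character (k + j) x = character k x * character j x := by
  simp only [character, Pi.add_apply, fourier_add, ContinuousMap.coe_mk,
    ← Finset.prod_mul_distrib]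

theorem character_single {d : ℕ} (x : Torus d) (i : Fin d) :
    character (Pi.single i 1) x = fourier 1 (x i) := by
  simp only [character, ContinuousMap.coe_mk]
  rw [Finset.prod_eq_single i]
  · simp
  · intro j _ hj
    simp [Pi.single_eq_of_ne hj]
  · simp

/-- The star subalgebra of `C(𝕋^d, ℂ)` generated by the characters. -/
def characterSubalgebra (d : ℕ) : StarSubalgebra ℂ C(Torus d, ℂ) where
  toSubalgebra := Algebra.adjoin ℂ (Set.range character)
  star_mem' := by
    change Algebra.adjoin ℂ (Set.range character) ≤
      star (Algebra.adjoin ℂ (Set.range character))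
    refine Algebra.adjoin_le ?_
    rintro _ ⟨n, rfl⟩
    refine Algebra.subset_adjoin ⟨-n, ?_⟩
    ext1 x
    simp only [character_neg, starRingEnd_apply, ContinuousMap.star_apply]

theorem characterSubalgebra_coe (d : ℕ) :
    Subalgebra.toSubmodule (characterSubalgebra d).toSubalgebra =
      Submodule.span ℂ (Set.range (character (d := d))) := by
  apply Algebra.adjoin_eq_span_of_subset
  refine .trans (fun x => Submonoid.closure_induction (fun _ => id) ⟨0, ?_⟩ ?_)
    Submodule.subset_span
  · ext z
    simp [character]
  · rintro _ _ _ _ ⟨m, rfl⟩ ⟨n, rfl⟩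
    refine ⟨m + n, ?_⟩
    ext z
    simp [character_add]

theorem characterSubalgebra_separatesPoints (d : ℕ) :
    (characterSubalgebra d).SeparatesPoints := by
  intro x y hxy
  rw [Ne, funext_iff, not_forall] at hxy
  obtain ⟨i, hi⟩ := hxy
  refine ⟨_, ⟨character (Pi.single i 1), Algebra.subset_adjoin ⟨Pi.single i 1, rfl⟩, rfl⟩, ?_⟩
  dsimp only
  rw [character_single, character_single, fourier_one, fourier_one]
  contrapose! hi
  exact AddCircle.injective_toCircle Real.two_pi_pos.ne' (Circle.ext hi)

theorem span_character_closure (d : ℕ) :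
    (Submodule.span ℂ (Set.range (character (d := d)))).topologicalClosure = ⊤ := by
  rw [← characterSubalgebra_coe]
  exact congr_arg (Subalgebra.toSubmodule <| StarSubalgebra.toSubalgebra ·)
    (ContinuousMap.starSubalgebra_topologicalClosure_eq_top_of_separatesPoints _
      (characterSubalgebra_separatesPoints d))

theorem norm_const_ne_zero (d : ℕ) :
    (((2 * Real.pi) ^ (-(d : ℝ) / 2) : ℝ) : ℂ) ≠ 0 := by
  exact_mod_cast (Real.rpow_pos_of_pos Real.two_pi_pos _).ne'

theorem span_expo_closure (d : ℕ) :
    (Submodule.span ℂ (Set.range (expo (d := d)))).topologicalClosure = ⊤ := by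
  have h1 : (Submodule.span ℂ (Set.range fun k : Fin d → ℤ =>
      ContinuousMap.toLp (E := ℂ) 2 (volume : Measure (Torus d)) ℂ
        (character k))).topologicalClosure = ⊤ := by
    simpa only [Submodule.map_span, ContinuousLinearMap.coe_coe, ← Set.range_comp,
      Function.comp_def] using
      (ContinuousMap.toLp_denseRange ℂ (volume : Measure (Torus d)) ℂ
        (by norm_num : (2 : ENNReal) ≠ ⊤)).topologicalClosure_map_submodule
        (span_character_closure d)
  rw [eq_top_iff, ← h1]
  apply Submodule.topologicalClosure_mono
  rw [Submodule.span_le]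
  rintro _ ⟨k, rfl⟩
  have h2 : ContinuousMap.toLp (E := ℂ) 2 (volume : Measure (Torus d)) ℂ (character k) =
      (((2 * Real.pi) ^ (-(d : ℝ) / 2) : ℝ) : ℂ)⁻¹ • expo k := by
    rw [expo, map_smul, smul_smul, inv_mul_cancel₀ (norm_const_ne_zero d), one_smul]
  simp only [SetLike.mem_coe]
  rw [h2]
  exact Submodule.smul_mem _ _ (Submodule.subset_span ⟨k, rfl⟩)

theorem integral_fourier (n : ℤ) :
    ∫ x : AddCircle (2 * Real.pi), fourier n x = if n = 0 then ((2 * Real.pi : ℝ) : ℂ) else 0 := by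
  split_ifs with hn
  · subst hn
    simp [measureReal_def, Real.pi_pos.le]
  · have h := (orthonormal_iff_ite.mp (orthonormal_fourier (T := 2 * Real.pi))) 0 n
    rw [if_neg (Ne.symm hn), ContinuousMap.inner_toLp] at h
    rw [AddCircle.volume_eq_smul_haarAddCircle, integral_smul_measure]
    simp only [fourier_zero, map_one, mul_one] at h
    rw [h, smul_zero]

theorem orthonormal_expo (d : ℕ) : Orthonormal ℂ (expo (d := d)) := by
  rw [orthonormal_iff_ite]
  intro m n
  have h0 : ∫ x : Torus d, character n x * (starRingEnd ℂ) (character m x) =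
      if m = n then (((2 * Real.pi) ^ (d : ℝ) : ℝ) : ℂ) else 0 := by
    simp only [← character_neg, ← character_add]
    simp only [character, ContinuousMap.coe_mk]
    rw [MeasureTheory.integral_fintype_prod_volume_eq_prod
      (fun i x => fourier ((n + -m) i) x)]
    simp only [integral_fourier]
    split_ifs with h
    · subst h
      simp
    · obtain ⟨i, hi⟩ := Function.ne_iff.mp h
      apply Finset.prod_eq_zero (Finset.mem_univ i)
      rw [if_neg]
      simp only [Pi.add_apply, Pi.neg_apply]
      omega
  simp only [expo, map_smul, inner_smul_left, inner_smul_right, ContinuousMap.inner_toLp, h0]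
  split_ifs with h
  · rw [Complex.conj_ofReal, ← Complex.ofReal_mul, ← Complex.ofReal_mul,
      ← Real.rpow_add Real.two_pi_pos, ← Real.rpow_add Real.two_pi_pos]
    ring_nf
    simp
  · simp

/-- The Hilbert basis `(e_k)_{k ∈ ℤ^d}` of `L²(𝕋^d)`. -/
def fourierBasis (d : ℕ) : HilbertBasis (Fin d → ℤ) ℂ (L2 d) :=
  HilbertBasis.mk (orthonormal_expo d) (span_expo_closure d).ge

/-- The Fourier coefficient `û(k) = ⟨e_k, u⟩ = ∫ u(x) e^{-ik·x} (2π)^{-d/2} dx`. -/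
def coeff {d : ℕ} (u : L2 d) (k : Fin d → ℤ) : ℂ := inner ℂ (expo k) u

theorem coeff_eq_repr {d : ℕ} (u : L2 d) (k : Fin d → ℤ) :
    coeff u k = (fourierBasis d).repr u k := by
  rw [HilbertBasis.repr_apply_apply, fourierBasis, HilbertBasis.coe_mk, coeff]

/-! ### The Hamiltonian and its propagator -/

/-- The lattice point `k ∈ ℤ^d`, seen in `ℝ^d`. -/
def latticePoint {d : ℕ} (k : Fin d → ℤ) : Freq d := WithLp.toLp 2 fun i => (k i : ℝ)

theorem memlp_phase {d : ℕ} (φ : (Fin d → ℤ) → ℝ) (u : L2 d) :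
    Memℓp (fun k => Complex.exp (-Complex.I * (φ k : ℂ)) * coeff u k) 2 := by
  have h := lp.memℓp ((fourierBasis d).repr u)
  rw [memℓp_gen_iff (by norm_num)] at h ⊢
  refine h.congr fun k => ?_
  rw [norm_mul, ← coeff_eq_repr]
  have : ‖Complex.exp (-Complex.I * (φ k : ℂ))‖ = 1 := by
    rw [Complex.norm_exp]; simp
  rw [this, one_mul]

/-- The propagator `S_h^t = e^{-i (t/h) H(hD_x)}` on `L²(𝕋^d)`: the Fourier multiplier sending
`e_k` to `e^{-i (t/h) H(hk)} e_k`. -/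
def propagator {d : ℕ} (H : Freq d → ℝ) (h t : ℝ) (u : L2 d) : L2 d :=
  (fourierBasis d).repr.symm
    ⟨fun k => Complex.exp (-Complex.I * ((t / h * H (h • latticePoint k) : ℝ) : ℂ)) * coeff u k,
      memlp_phase (fun k => t / h * H (h • latticePoint k)) u⟩

/-- `u` is a normalised eigenfunction of the Fourier multiplier `H(hD_x)`:
`‖u‖ = 1` and `H(hD_x) u = E u` for some real `E`. -/
def IsNormalisedEigenfunction {d : ℕ} (H : Freq d → ℝ) (h : ℝ) (u : L2 d) : Prop :=
  ‖u‖ = 1 ∧ ∃ E : ℝ, ∀ k : Fin d → ℤ,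
    (H (h • latticePoint k) : ℂ) * coeff u k = (E : ℂ) * coeff u k

/-- `τ_h^H(O) = h sup { |H(hk) - H(hj)|⁻¹ : H(hk) ≠ H(hj), hk, hj ∈ hℤ^d ∩ O } ∈ [0, ∞]`. -/
def spectralScale {d : ℕ} (H : Freq d → ℝ) (O : Set (Freq d)) (h : ℝ) : ENNReal :=
  ENNReal.ofReal h * ⨆ (k : Fin d → ℤ) (j : Fin d → ℤ) (_ : h • latticePoint k ∈ O)
    (_ : h • latticePoint j ∈ O) (_ : H (h • latticePoint k) ≠ H (h • latticePoint j)),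
    ENNReal.ofReal |H (h • latticePoint k) - H (h • latticePoint j)|⁻¹

/-! ### Weyl quantization and Wigner distributions -/

/-- The projection `ℝ^d → 𝕋^d`. -/
def toTorus {d : ℕ} (x : Freq d) : Torus d := fun i => ((x i : ℝ) : AddCircle (2 * Real.pi))

/-- The space `C_c^∞(T^*𝕋^d)` of complex valued test functions; smoothness is that of the
`2πℤ^d`-periodic lift to `ℝ^d × ℝ^d`. -/
structure TestSymbol (d : ℕ) where
  toFun : Cotangent d → ℂ
  smooth' : ContDiff ℝ ∞ fun p : Freq d × Freq d => toFun (toTorus p.1, p.2)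
  hasCompactSupport' : HasCompactSupport toFun

instance {d : ℕ} : CoeFun (TestSymbol d) fun _ => Cotangent d → ℂ := ⟨TestSymbol.toFun⟩

/-- The Fourier coefficient in `x` of a symbol,
`â_k(ξ) = ∫ a(x, ξ) e^{-ik·x} (2π)^{-d/2} dx`. -/
def symbolCoeff {d : ℕ} (a : TestSymbol d) (k : Fin d → ℤ) (ξ : Freq d) : ℂ :=
  (((2 * Real.pi) ^ (-(d : ℝ) / 2) : ℝ) : ℂ) * ∫ x : Torus d, a (x, ξ) * character (-k) x

/-- The Weyl quantization `Op_h(a)`, acting on `L²(𝕋^d)`. It is determined by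
`Op_h(a) e_k = (2π)^{-d/2} ∑_j â_{j-k}(h(k+j)/2) e_j`, which is what the Weyl formula
`(2πh)^{-d} ∫∫ a((x+y)/2, ξ) e^{i(x-y)·ξ/h} u(y) dy dξ` gives for `u = e_k`. -/
def weylOp {d : ℕ} (h : ℝ) (a : TestSymbol d) (u : L2 d) : L2 d :=
  ∑' k : Fin d → ℤ, coeff u k • ∑' j : Fin d → ℤ,
    ((((2 * Real.pi) ^ (-(d : ℝ) / 2) : ℝ) : ℂ) *
      symbolCoeff a (j - k) ((h / 2) • latticePoint (k + j))) • expo j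

/-- The Wigner distribution `w_u^h` of `u` at scale `h`, tested against `a`:
`⟨u, Op_h(a) u⟩`. -/
def wigner {d : ℕ} (h : ℝ) (u : L2 d) (a : TestSymbol d) : ℂ := inner ℂ u (weylOp h a u)

/-! ### Semiclassical measures -/

/-- A sequence `h_n → 0⁺` together with a normalised sequence `u_n` in `L²(𝕋^d)`. -/
structure IsNormalisedSequence {d : ℕ} (h : ℕ → ℝ) (u : ℕ → L2 d) : Prop where
  pos : ∀ n, 0 < h n
  tendsto_zero : Tendsto h atTop (𝓝 0)
  norm_eq_one : ∀ n, ‖u n‖ = 1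

/-- The (time-independent) Radon measure `μ₀` is a semiclassical measure of `(u_n)`, that is, an
accumulation point in `D'(T^*𝕋^d)`, along a subsequence, of the Wigner distributions of `u_n`
at scale `h_n`. -/
def IsSemiclassicalMeasure {d : ℕ} (h : ℕ → ℝ) (u : ℕ → L2 d) (μ₀ : Measure (Cotangent d)) :
    Prop :=
  IsLocallyFiniteMeasure μ₀ ∧ ∃ ι : ℕ → ℕ, StrictMono ι ∧ ∀ a : TestSymbol d,
    Tendsto (fun n => wigner (h (ι n)) (u (ι n)) a) atTop (𝓝 (∫ z, a z ∂μ₀))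

/-- `∫ θ(t) ∫ a(x, ξ) μ(t, dx, dξ) dt` for `θ ∈ L¹(ℝ)` and `a ∈ C_c^∞(T^*𝕋^d)`. Elements of
`L^∞(ℝ; M_+(T^*𝕋^d))` are given by finite kernels `t ↦ μ(t, ·)` (measurable in `t`, of uniformly
bounded mass), two of them being identified when they have the same pairings, that is, when they
agree for almost every `t`. The weak-* topology is that of pointwise convergence of the pairings. -/
def pairing {d : ℕ} (μ : Kernel ℝ (Cotangent d))
    (p : {θ : ℝ → ℂ // Integrable θ} × TestSymbol d) : ℂ :=
  ∫ t : ℝ, p.1.1 t * ∫ z, p.2 z ∂(μ t)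

/-- `μ ∈ L^∞(ℝ; M_+(T^*𝕋^d))` is the time-dependent semiclassical measure at time scale `τ`
obtained through the normalised sequence `(u_n)`: the distributions
`w_h(t, ·) = w^h_{S_h^{τ_h t} u_h}` converge weakly-* to `μ` along `h = h_n`. The set `M̃(τ)`
consists of the `μ` obtained through some such sequence. -/
structure IsObtainedThrough {d : ℕ} (H : Freq d → ℝ) (τ : ℝ → ℝ) (h : ℕ → ℝ) (u : ℕ → L2 d)
    (μ : Kernel ℝ (Cotangent d)) : Prop where
  finite : IsFiniteKernel μ
  normalised : IsNormalisedSequence h u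
  tendsto : ∀ p : {θ : ℝ → ℂ // Integrable θ} × TestSymbol d,
    Tendsto
      (fun n => ∫ t : ℝ, p.1.1 t * wigner (h n) (propagator H (h n) (τ (h n) * t) (u n)) p.2)
      atTop (𝓝 (pairing μ p))

/-- The set `M̃(∞)` of weak-* limit points of Wigner distributions of normalised eigenfunctions
of `H(hD_x)`, as `h → 0⁺`. -/
def eigenMeasures {d : ℕ} (H : Freq d → ℝ) : Set (Measure (Cotangent d)) :=
  {ν | ∃ (h : ℕ → ℝ) (u : ℕ → L2 d), IsNormalisedSequence h u ∧
    (∀ n, IsNormalisedEigenfunction H (h n) (u n)) ∧ IsSemiclassicalMeasure h u ν}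

/-- The closed convex hull, for the weak-* topology of `L^∞(ℝ; M_+(T^*𝕋^d))`, of a set `S` of
measures on `T^*𝕋^d`, which are seen as measures `μ(t, ·) = ν` not depending on `t`. -/
def closedConvHull {d : ℕ} (S : Set (Measure (Cotangent d))) : Set (Kernel ℝ (Cotangent d)) :=
  {μ | IsFiniteKernel μ ∧
    pairing μ ∈ closure (convexHull ℝ ((fun ν => pairing (Kernel.const ℝ ν)) '' S))}

end TorusFlow

end

/-!
The proof writes everything in Fourier coefficients. With `α_m(ξ) = (2π)^{-d} ∫ a(x, ξ) e^{-im·x} dx`,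
the Wigner distribution `⟨u, Op_h(a) u⟩` is the form `∑ conj(û_{k+m}) û_k α_m(h(2k+m)/2)` over pairs
`(m, k)` (`wigner_eq`), and `|α_m|` is bounded by a summable family in `m`, uniformly in `ξ`
(`exists_summable_bound`). Limits of such forms can therefore be computed one diagonal `m` at a
time (`tendsto_diagForm_zero`).

Integrating the evolved distribution against `θ(t)` multiplies the entry `(m, k)` by the Fourier
integral of `θ` at `(τ/h)(H(h(k+m)) - H(hk))`. If both frequencies lie in `O` and the energies
differ, this argument tends to infinity uniformly, because `τ` is much longer than the spectral
scale of `O`, and the Riemann–Lebesgue lemma kills the entry. Entries with a frequency outside `O`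
are controlled by the mass of `u` there, which vanishes locally since `μ₀` does not charge the
complement of `O` (`tendsto_mass_zero`). Only pairs in `O` with equal energies survive
(`tendsto_timeAverage_sub_resonant`), and their sum is `∑_E ‖u_E‖² w_{v_E}(a)`, where `u_E` is the
part of `u` with frequencies in `O` and energy `E`, and `v_E = u_E / ‖u_E‖` is an eigenfunction.

So `μ` is a limit of sub-convex combinations of Wigner distributions of eigenfunctions. If it were
not in the closed convex hull, a continuous functional would separate it strictly; since the zero
measure is a limit of eigenfunctions (`zero_mem_eigenMeasures`), the functional would be large on
some eigenfunction for each small `h` (`exists_eigenfunction_ge`), hence on a semiclassical measure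
of these eigenfunctions, a contradiction. That normalised sequences have semiclassical measures
(`exists_isSemiclassicalMeasure`) follows by comparing Wigner distributions with positive measures
of Husimi type (`tendsto_wigner_sub_husimi`), which are probability measures and so have vague
limits (`exists_subseq_vague_limit`).
-/

noncomputable section

namespace TorusFlow

/-! ### Sesquilinear forms on `ℓ²(ℤ^d)` organised by diagonals -/

/-- The form `∑_{j,k} conj (c_j) c_k K` on `ℓ²(ℤ^d)`, the pair `(j, k)` being recorded as
`(m, k)` with `m = j - k`, so that `m` labels the diagonals of the matrix `K`. -/
def diagForm {d : ℕ} (K : (Fin d → ℤ) × (Fin d → ℤ) → ℂ) (c : (Fin d → ℤ) → ℂ) : ℂ :=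
  ∑' p : (Fin d → ℤ) × (Fin d → ℤ), (starRingEnd ℂ) (c (p.2 + p.1)) * c p.2 * K p

section Forms

variable {d : ℕ} {c : (Fin d → ℤ) → ℂ}

theorem summable_shift_sq (hc : Summable fun k => ‖c k‖ ^ 2) (m : Fin d → ℤ) :
    Summable fun k => ‖c (k + m)‖ ^ 2 :=
  hc.comp_injective (i := fun k => k + m) (add_left_injective m)

theorem summable_shift_mul (hc : Summable fun k => ‖c k‖ ^ 2) (m : Fin d → ℤ) :
    Summable fun k => ‖c (k + m)‖ * ‖c k‖ := by
  refine Summable.of_nonneg_of_le (fun k => by positivity) (fun k => ?_)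
    ((summable_shift_sq hc m).add hc)
  nlinarith [sq_nonneg (‖c (k + m)‖ - ‖c k‖), sq_nonneg ‖c (k + m)‖, sq_nonneg ‖c k‖]

theorem tsum_shift_mul_le (hc : Summable fun k => ‖c k‖ ^ 2) (m : Fin d → ℤ) :
    ∑' k, ‖c (k + m)‖ * ‖c k‖ ≤ ∑' k, ‖c k‖ ^ 2 := by
  have h1 : ∑' k, ‖c (k + m)‖ ^ 2 = ∑' k, ‖c k‖ ^ 2 :=
    (Equiv.addRight m).tsum_eq (fun k => ‖c k‖ ^ 2)
  have h2 : ∑' k, ‖c (k + m)‖ * ‖c k‖ ≤ ∑' k, (‖c (k + m)‖ ^ 2 / 2 + ‖c k‖ ^ 2 / 2) := by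
    refine (summable_shift_mul hc m).tsum_le_tsum (fun k => ?_)
      (((summable_shift_sq hc m).div_const 2).add (hc.div_const 2))
    nlinarith [sq_nonneg (‖c (k + m)‖ - ‖c k‖)]
  rw [((summable_shift_sq hc m).div_const 2).tsum_add (hc.div_const 2), tsum_div_const,
    tsum_div_const, h1] at h2
  linarith

variable {K : (Fin d → ℤ) × (Fin d → ℤ) → ℂ} {s : (Fin d → ℤ) → ℝ}

theorem norm_diagForm_term (p : (Fin d → ℤ) × (Fin d → ℤ)) :
    ‖(starRingEnd ℂ) (c (p.2 + p.1)) * c p.2 * K p‖ =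
      ‖c (p.2 + p.1)‖ * ‖c p.2‖ * ‖K p‖ := by
  rw [norm_mul, norm_mul, RCLike.norm_conj]

theorem summable_diagonal (hc : Summable fun k => ‖c k‖ ^ 2)
    (hK : ∀ m k, ‖K (m, k)‖ ≤ s m) (m : Fin d → ℤ) :
    Summable fun k => ‖c (k + m)‖ * ‖c k‖ * ‖K (m, k)‖ :=
  Summable.of_nonneg_of_le (fun k => by positivity)
    (fun k => mul_le_mul_of_nonneg_left (hK m k) (by positivity))
    ((summable_shift_mul hc m).mul_right (s m))

theorem tsum_diagonal_le (hc : Summable fun k => ‖c k‖ ^ 2)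
    (hK : ∀ m k, ‖K (m, k)‖ ≤ s m) (m : Fin d → ℤ) :
    ∑' k, ‖c (k + m)‖ * ‖c k‖ * ‖K (m, k)‖ ≤ (∑' k, ‖c k‖ ^ 2) * s m := by
  have h0 : 0 ≤ s m := (norm_nonneg _).trans (hK m 0)
  calc ∑' k, ‖c (k + m)‖ * ‖c k‖ * ‖K (m, k)‖
      ≤ ∑' k, ‖c (k + m)‖ * ‖c k‖ * s m :=
        (summable_diagonal hc hK m).tsum_le_tsum
          (fun k => mul_le_mul_of_nonneg_left (hK m k) (by positivity))
          ((summable_shift_mul hc m).mul_right (s m))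
    _ = (∑' k, ‖c (k + m)‖ * ‖c k‖) * s m := tsum_mul_right
    _ ≤ _ := mul_le_mul_of_nonneg_right (tsum_shift_mul_le hc m) h0

theorem summable_norm_diagForm (hc : Summable fun k => ‖c k‖ ^ 2) (hs : Summable s)
    (hK : ∀ m k, ‖K (m, k)‖ ≤ s m) :
    Summable fun p : (Fin d → ℤ) × (Fin d → ℤ) => ‖c (p.2 + p.1)‖ * ‖c p.2‖ * ‖K p‖ := by
  rw [summable_prod_of_nonneg (fun p => by positivity)]
  refine ⟨summable_diagonal hc hK, ?_⟩
  exact Summable.of_nonneg_of_le (fun m => tsum_nonneg fun k => by positivity)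
    (tsum_diagonal_le hc hK) (hs.mul_left _)

theorem summable_diagForm (hc : Summable fun k => ‖c k‖ ^ 2) (hs : Summable s)
    (hK : ∀ m k, ‖K (m, k)‖ ≤ s m) :
    Summable fun p : (Fin d → ℤ) × (Fin d → ℤ) =>
      (starRingEnd ℂ) (c (p.2 + p.1)) * c p.2 * K p := by
  refine Summable.of_norm ?_
  simpa only [norm_diagForm_term] using summable_norm_diagForm hc hs hK

theorem norm_diagForm_le (hc : Summable fun k => ‖c k‖ ^ 2) (hs : Summable s)
    (hK : ∀ m k, ‖K (m, k)‖ ≤ s m) :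
    ‖diagForm K c‖ ≤ ∑' m, ∑' k, ‖c (k + m)‖ * ‖c k‖ * ‖K (m, k)‖ := by
  have h := summable_norm_diagForm hc hs hK
  have h1 : ‖diagForm K c‖ ≤
      ∑' p : (Fin d → ℤ) × (Fin d → ℤ), ‖c (p.2 + p.1)‖ * ‖c p.2‖ * ‖K p‖ := by
    have := norm_tsum_le_tsum_norm (f := fun p : (Fin d → ℤ) × (Fin d → ℤ) =>
      (starRingEnd ℂ) (c (p.2 + p.1)) * c p.2 * K p)
      (by simpa only [norm_diagForm_term] using h)
    simpa only [norm_diagForm_term, diagForm] using this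
  rwa [h.tsum_prod' (summable_diagonal hc hK)] at h1

theorem diagForm_sub {K' : (Fin d → ℤ) × (Fin d → ℤ) → ℂ} {s' : (Fin d → ℤ) → ℝ}
    (hc : Summable fun k => ‖c k‖ ^ 2) (hs : Summable s)
    (hK : ∀ m k, ‖K (m, k)‖ ≤ s m) (hs' : Summable s') (hK' : ∀ m k, ‖K' (m, k)‖ ≤ s' m) :
    diagForm (fun p => K p - K' p) c = diagForm K c - diagForm K' c := by
  simp only [diagForm, mul_sub]
  exact (summable_diagForm hc hs hK).tsum_sub (summable_diagForm hc hs' hK')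

/-- Dominated convergence along the diagonals: if the matrices `K_n` have diagonals bounded by a
summable family, then the forms tend to `0` as soon as each single diagonal contributes `o(1)`. -/
theorem tendsto_diagForm_zero {c : ℕ → (Fin d → ℤ) → ℂ}
    {K : ℕ → (Fin d → ℤ) × (Fin d → ℤ) → ℂ}
    (hc : ∀ n, Summable fun k => ‖c n k‖ ^ 2) (hc1 : ∀ n, ∑' k, ‖c n k‖ ^ 2 ≤ 1)
    (hs : Summable s) (hK : ∀ n m k, ‖K n (m, k)‖ ≤ s m)
    (hlim : ∀ m, Tendsto (fun n => ∑' k, ‖c n (k + m)‖ * ‖c n k‖ * ‖K n (m, k)‖) atTop (𝓝 0)) :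
    Tendsto (fun n => diagForm (K n) (c n)) atTop (𝓝 0) := by
  refine squeeze_zero_norm (fun n => norm_diagForm_le (hc n) hs (hK n)) ?_
  have h := tendsto_tsum_of_dominated_convergence (𝓕 := atTop) (β := Fin d → ℤ) (bound := s)
    (f := fun n m => ∑' k, ‖c n (k + m)‖ * ‖c n k‖ * ‖K n (m, k)‖) (g := fun _ => 0) hs hlim
    (Eventually.of_forall fun n m => ?_)
  · simpa using h
  · rw [Real.norm_of_nonneg (tsum_nonneg fun k => by positivity)]
    have h0 : 0 ≤ s m := (norm_nonneg _).trans (hK n m 0)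
    exact (tsum_diagonal_le (hc n) (hK n) m).trans (mul_le_of_le_one_left h0 (hc1 n))

/-- A diagonal contributes at most the supremum of its entries. -/
theorem tendsto_diagonal_zero_of_unif {c : ℕ → (Fin d → ℤ) → ℂ}
    {K : ℕ → (Fin d → ℤ) × (Fin d → ℤ) → ℂ}
    (hc : ∀ n, Summable fun k => ‖c n k‖ ^ 2) (hc1 : ∀ n, ∑' k, ‖c n k‖ ^ 2 ≤ 1)
    (m : Fin d → ℤ)
    (hunif : ∀ ε > 0, ∀ᶠ n in atTop, ∀ k, ‖K n (m, k)‖ ≤ ε) :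
    Tendsto (fun n => ∑' k, ‖c n (k + m)‖ * ‖c n k‖ * ‖K n (m, k)‖) atTop (𝓝 0) := by
  rw [Metric.tendsto_nhds]
  intro ε hε
  filter_upwards [hunif (ε / 2) (half_pos hε)] with n hn
  rw [Real.dist_0_eq_abs, abs_of_nonneg (tsum_nonneg fun k => by positivity)]
  have h1 : ∑' k, ‖c n (k + m)‖ * ‖c n k‖ * ‖K n (m, k)‖ ≤
      ∑' k, ‖c n (k + m)‖ * ‖c n k‖ * (ε / 2) := by
    have hm := (summable_shift_mul (hc n) m).mul_right (ε / 2)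
    refine Summable.tsum_le_tsum (fun k => mul_le_mul_of_nonneg_left (hn k) (by positivity))
      (Summable.of_nonneg_of_le (fun k => by positivity)
        (fun k => mul_le_mul_of_nonneg_left (hn k) (by positivity)) hm) hm
  rw [tsum_mul_right] at h1
  have h2 := (tsum_shift_mul_le (hc n) m).trans (hc1 n)
  nlinarith

end Forms

/-! ### Fourier coefficients -/

theorem hasSum_coeff_sq {d : ℕ} (u : L2 d) : HasSum (fun k => ‖coeff u k‖ ^ 2) (‖u‖ ^ 2) := by
  have h := lp.hasSum_norm (p := 2) (by norm_num) ((fourierBasis d).repr u)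
  simpa [coeff_eq_repr, LinearIsometryEquiv.norm_map] using h

theorem summable_coeff_sq {d : ℕ} (u : L2 d) : Summable fun k => ‖coeff u k‖ ^ 2 :=
  (hasSum_coeff_sq u).summable

theorem inner_expo_right {d : ℕ} (u : L2 d) (k : Fin d → ℤ) :
    inner ℂ u (expo k) = (starRingEnd ℂ) (coeff u k) :=
  (inner_conj_symm u (expo k)).symm

theorem coeff_expo {d : ℕ} (k j : Fin d → ℤ) : coeff (expo k) j = if j = k then 1 else 0 :=
  orthonormal_iff_ite.mp (orthonormal_expo d) j k

theorem memℓp_coeff {d : ℕ} {c : (Fin d → ℤ) → ℂ} (hc : Summable fun k => ‖c k‖ ^ 2) :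
    Memℓp c 2 := by
  rw [memℓp_gen_iff (by norm_num)]
  simpa using hc

/-- The function with a prescribed square summable family of Fourier coefficients. -/
def ofCoeff {d : ℕ} (c : (Fin d → ℤ) → ℂ) (hc : Summable fun k => ‖c k‖ ^ 2) : L2 d :=
  (fourierBasis d).repr.symm ⟨c, memℓp_coeff hc⟩

theorem coeff_ofCoeff {d : ℕ} (c : (Fin d → ℤ) → ℂ) (hc : Summable fun k => ‖c k‖ ^ 2)
    (k : Fin d → ℤ) : coeff (ofCoeff c hc) k = c k := by
  rw [coeff_eq_repr, ofCoeff, LinearIsometryEquiv.apply_symm_apply]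

theorem coeff_propagator {d : ℕ} (H : Freq d → ℝ) (h t : ℝ) (u : L2 d) (k : Fin d → ℤ) :
    coeff (propagator H h t u) k =
      Complex.exp (-Complex.I * ((t / h * H (h • latticePoint k) : ℝ) : ℂ)) * coeff u k := by
  rw [coeff_eq_repr, propagator, LinearIsometryEquiv.apply_symm_apply]

/-! ### Rapid decay of the Fourier coefficients of a symbol -/

section Symbols

variable {d : ℕ}

theorem isOpenQuotientMap_lift :
    IsOpenQuotientMap fun p : Freq d × Freq d => ((toTorus p.1, p.2) : Cotangent d) := by
  have h1 : IsOpenQuotientMap (toTorus (d := d)) := by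
    have h := IsOpenQuotientMap.piMap (ι := Fin d) (A := fun _ => ℝ)
      (B := fun _ => AddCircle (2 * Real.pi)) (f := fun _ (x : ℝ) => (x : AddCircle (2 * Real.pi)))
      (fun _ => QuotientAddGroup.isOpenQuotientMap_mk)
    exact h.comp (PiLp.homeomorph 2 (fun _ : Fin d => ℝ)).isOpenQuotientMap
  exact h1.prodMap IsOpenQuotientMap.id

theorem TestSymbol.continuous (a : TestSymbol d) : Continuous a :=
  isOpenQuotientMap_lift.isQuotientMap.continuous_iff.mpr a.smooth'.continuous

theorem TestSymbol.exists_bound (a : TestSymbol d) : ∃ C, ∀ z, ‖a z‖ ≤ C :=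
  a.continuous.bounded_above_of_compact_support a.hasCompactSupport'

theorem TestSymbol.exists_radius (a : TestSymbol d) :
    ∃ R, 0 < R ∧ ∀ x ξ, R < ‖ξ‖ → a (x, ξ) = 0 := by
  obtain ⟨R, hR⟩ := (a.hasCompactSupport'.isCompact.image continuous_snd).isBounded.exists_norm_le
  refine ⟨max R 1, by positivity, fun x ξ hξ => ?_⟩
  by_contra hne
  have := hR ξ ⟨(x, ξ), subset_tsupport _ hne, rfl⟩
  exact absurd (this.trans (le_max_left R 1)) (not_le.mpr hξ)

theorem toTorus_add_smul (y : Freq d) (i : Fin d) (t : ℝ) :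
    toTorus (y + t • EuclideanSpace.single i (1 : ℝ)) =
      toTorus y + Pi.single i (t : AddCircle (2 * Real.pi)) := by
  ext j
  rcases eq_or_ne j i with rfl | hj
  · simp [toTorus]
  · simp [toTorus, hj]

theorem TestSymbol.hasDerivAt_lift (a : TestSymbol d) (i : Fin d) (y ξ : Freq d) (t : ℝ) :
    HasDerivAt (fun t : ℝ => a (toTorus y + Pi.single i (t : AddCircle (2 * Real.pi)), ξ))
      (fderiv ℝ (fun p : Freq d × Freq d => a (toTorus p.1, p.2))
        (y + t • EuclideanSpace.single i (1 : ℝ), ξ) (EuclideanSpace.single i 1, 0)) t := by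
  have h1 : HasDerivAt (fun t : ℝ => ((y + t • EuclideanSpace.single i (1 : ℝ), ξ) :
      Freq d × Freq d)) (EuclideanSpace.single i 1, 0) t := by
    refine HasDerivAt.prodMk ?_ (hasDerivAt_const t ξ)
    simpa using ((hasDerivAt_id t).smul_const (EuclideanSpace.single i (1 : ℝ))).const_add y
  have h2 := ((a.smooth'.differentiable (by simp))
    (y + t • EuclideanSpace.single i (1 : ℝ), ξ)).hasFDerivAt
  have h3 := h2.comp_hasDerivAt t h1
  simp only [Function.comp_def, toTorus_add_smul] at h3
  exact h3

/-- The derivative `∂_{x_i} a` of a symbol, defined intrinsically on the torus. -/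
def TestSymbol.xDeriv (a : TestSymbol d) (i : Fin d) : TestSymbol d where
  toFun z := deriv (fun t : ℝ => a (z.1 + Pi.single i (t : AddCircle (2 * Real.pi)), z.2)) 0
  smooth' := by
    have h : (fun p : Freq d × Freq d => deriv (fun t : ℝ =>
        a (toTorus p.1 + Pi.single i (t : AddCircle (2 * Real.pi)), p.2)) 0) =
        fun p => fderiv ℝ (fun p : Freq d × Freq d => a (toTorus p.1, p.2)) p
          (EuclideanSpace.single i 1, 0) := by
      ext p
      have := (a.hasDerivAt_lift i p.1 p.2 0).deriv
      simpa using this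
    simp only [h]
    exact (a.smooth'.fderiv_right (m := ∞) (by simp)).clm_apply contDiff_const
  hasCompactSupport' := by
    obtain ⟨R, -, hR⟩ := a.exists_radius
    refine HasCompactSupport.intro
      (isCompact_univ.prod (isCompact_closedBall (0 : Freq d) R)) fun z hz => ?_
    have hz' : R < ‖z.2‖ := by
      simpa using hz
    simp [hR _ _ hz']

theorem TestSymbol.hasDerivAt_xDeriv (a : TestSymbol d) (i : Fin d) (x : Torus d) (ξ : Freq d)
    (t : ℝ) :
    HasDerivAt (fun t : ℝ => a (x + Pi.single i (t : AddCircle (2 * Real.pi)), ξ))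
      (a.xDeriv i (x + Pi.single i (t : AddCircle (2 * Real.pi)), ξ)) t := by
  obtain ⟨⟨y, η⟩, hy⟩ := isOpenQuotientMap_lift.surjective ((x, ξ) : Cotangent d)
  obtain ⟨rfl, rfl⟩ := Prod.ext_iff.mp hy
  have h1 := a.hasDerivAt_lift i y η t
  convert h1 using 1
  have h2 := (a.hasDerivAt_lift i (y + t • EuclideanSpace.single i (1 : ℝ)) η 0).deriv
  simp only [toTorus_add_smul, zero_smul, add_zero] at h2
  exact h2

theorem character_apply_add (m : Fin d → ℤ) (x y : Torus d) :
    character m (x + y) = character m x * character m y := by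
  simp only [character, ContinuousMap.coe_mk, ← Finset.prod_mul_distrib]
  refine Finset.prod_congr rfl fun i _ => ?_
  simp [fourier_apply, smul_add, AddCircle.toCircle_add]

theorem character_apply_single (m : Fin d → ℤ) (i : Fin d) (t : ℝ) :
    character m (Pi.single i (t : AddCircle (2 * Real.pi))) =
      Complex.exp (Complex.I * m i * t) := by
  simp only [character, ContinuousMap.coe_mk]
  rw [Finset.prod_eq_single i]
  · rw [Pi.single_eq_same, fourier_coe_apply]
    congr 1
    have : (Real.pi : ℂ) ≠ 0 := by exact_mod_cast Real.pi_ne_zero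
    push_cast
    field_simp
  · intro j _ hj
    simp [Pi.single_eq_of_ne hj]
  · simp

theorem norm_character (m : Fin d → ℤ) (x : Torus d) : ‖character m x‖ = 1 := by
  simp [character, fourier_apply, Circle.norm_coe]

theorem continuous_symbol_mul_character (a : TestSymbol d) (m : Fin d → ℤ) :
    Continuous fun z : Cotangent d => a z * character m z.1 :=
  a.continuous.mul ((character m).continuous.comp continuous_fst)

theorem integral_xDeriv_mul_character (a : TestSymbol d) (i : Fin d) (m : Fin d → ℤ)
    (ξ : Freq d) :
    ∫ x : Torus d, a.xDeriv i (x, ξ) * character (-m) x =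
      Complex.I * m i * ∫ x : Torus d, a (x, ξ) * character (-m) x := by
  set e : ℝ → Torus d := fun t => Pi.single i (t : AddCircle (2 * Real.pi)) with he
  have hcont : ∀ (b : TestSymbol d) (t : ℝ),
      Continuous fun x : Torus d => b (x + e t, ξ) * character (-m) x := fun b t =>
    (b.continuous.comp ((continuous_id.add continuous_const).prodMk continuous_const)).mul
      (character (-m)).continuous
  obtain ⟨C, hC⟩ := (a.xDeriv i).exists_bound
  have h1 : HasDerivAt (fun t : ℝ => ∫ x : Torus d, a (x + e t, ξ) * character (-m) x)
      (∫ x : Torus d, a.xDeriv i (x + e 0, ξ) * character (-m) x) 0 := by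
    refine (hasDerivAt_integral_of_dominated_loc_of_deriv_le (μ := volume)
      (F := fun (t : ℝ) (x : Torus d) => a (x + e t, ξ) * character (-m) x)
      (F' := fun (t : ℝ) (x : Torus d) => a.xDeriv i (x + e t, ξ) * character (-m) x)
      (bound := fun _ => C) (s := Set.univ) univ_mem
      (Eventually.of_forall fun t => (hcont a t).aestronglyMeasurable) ?_
      (hcont _ 0).aestronglyMeasurable ?_ (integrable_const C) ?_).2
    · exact (hcont a 0).integrable_of_hasCompactSupport (HasCompactSupport.of_compactSpace _)
    · refine Eventually.of_forall fun x t _ => ?_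
      rw [norm_mul, norm_character, mul_one]
      exact hC _
    · exact Eventually.of_forall fun x t _ => (a.hasDerivAt_xDeriv i x ξ t).mul_const _
  have h2 : (fun t : ℝ => ∫ x : Torus d, a (x + e t, ξ) * character (-m) x) =
      fun t : ℝ => Complex.exp (Complex.I * m i * t) *
        ∫ x : Torus d, a (x, ξ) * character (-m) x := by
    ext t
    rw [← integral_add_right_eq_self (fun x : Torus d => a (x, ξ) * character (-m) x) (e t),
      ← integral_const_mul]
    congr 1
    ext x
    have h3 : character (-m) (e t) * Complex.exp (Complex.I * m i * t) = 1 := by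
      rw [he, character_apply_single, ← Complex.exp_add]
      simp
    rw [character_apply_add]
    linear_combination (-(a (x + e t, ξ) * character (-m) x)) * h3
  have h4 : HasDerivAt (fun t : ℝ => Complex.exp (Complex.I * m i * t) *
      ∫ x : Torus d, a (x, ξ) * character (-m) x)
      (Complex.I * m i * ∫ x : Torus d, a (x, ξ) * character (-m) x) 0 := by
    have h5 : HasDerivAt (fun t : ℝ => Complex.I * m i * (t : ℂ)) (Complex.I * m i) 0 := by
      simpa using (Complex.ofRealCLM.hasDerivAt (x := (0 : ℝ))).const_mul (Complex.I * m i)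
    simpa using (h5.cexp).mul_const (∫ x : Torus d, a (x, ξ) * character (-m) x)
  rw [h2] at h1
  have := h1.unique h4
  simpa [he] using this

/-- The coefficient `α_m(ξ) = (2π)^{-d} ∫ a(x, ξ) e^{-im·x} dx`: the matrix of `Op_h(a)` in the
basis `(e_k)` has the entry `α_{j-k}(h(j+k)/2)` in row `j` and column `k`. -/
def weylCoeff (a : TestSymbol d) (m : Fin d → ℤ) (ξ : Freq d) : ℂ :=
  (((2 * Real.pi) ^ (-(d : ℝ) / 2) : ℝ) : ℂ) * symbolCoeff a m ξ

theorem weylCoeff_eq (a : TestSymbol d) (m : Fin d → ℤ) (ξ : Freq d) :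
    weylCoeff a m ξ = (((2 * Real.pi) ^ (-(d : ℝ)) : ℝ) : ℂ) *
      ∫ x : Torus d, a (x, ξ) * character (-m) x := by
  rw [weylCoeff, symbolCoeff, ← mul_assoc, ← Complex.ofReal_mul,
    ← Real.rpow_add Real.two_pi_pos]
  congr 4
  ring

theorem weylCoeff_xDeriv (a : TestSymbol d) (i : Fin d) (m : Fin d → ℤ) (ξ : Freq d) :
    weylCoeff (a.xDeriv i) m ξ = Complex.I * m i * weylCoeff a m ξ := by
  rw [weylCoeff_eq, weylCoeff_eq, integral_xDeriv_mul_character]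
  ring

theorem exists_norm_weylCoeff_le (a : TestSymbol d) : ∃ C, ∀ m ξ, ‖weylCoeff a m ξ‖ ≤ C := by
  obtain ⟨C, hC⟩ := a.exists_bound
  refine ⟨(2 * Real.pi) ^ (-(d : ℝ)) * (C * (volume : Measure (Torus d)).real Set.univ),
    fun m ξ => ?_⟩
  rw [weylCoeff_eq, norm_mul, Complex.norm_real,
    Real.norm_of_nonneg (Real.rpow_nonneg Real.two_pi_pos.le _)]
  refine mul_le_mul_of_nonneg_left (norm_integral_le_of_norm_le_const
    (Eventually.of_forall fun x => ?_)) (Real.rpow_nonneg Real.two_pi_pos.le _)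
  rw [norm_mul, norm_character, mul_one]
  exact hC _

theorem exists_abs_pow_mul_norm_weylCoeff_le (i : Fin d) (p : ℕ) (a : TestSymbol d) :
    ∃ C, ∀ m ξ, |(m i : ℝ)| ^ p * ‖weylCoeff a m ξ‖ ≤ C := by
  induction p generalizing a with
  | zero => simpa using exists_norm_weylCoeff_le a
  | succ p ih =>
    obtain ⟨C, hC⟩ := ih (a.xDeriv i)
    refine ⟨C, fun m ξ => ?_⟩
    have h := hC m ξ
    rw [weylCoeff_xDeriv, norm_mul, norm_mul, Complex.norm_I, one_mul,
      Complex.norm_intCast] at h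
    rw [pow_succ, mul_assoc]
    exact h

theorem summable_pi_prod {g : ℤ → ℝ} (hg : Summable g) (hg0 : ∀ n, 0 ≤ g n) :
    Summable fun m : Fin d → ℤ => ∏ i, g (m i) := by
  classical
  refine summable_of_sum_le (c := ∏ _i : Fin d, ∑' n, g n)
    (fun m => Finset.prod_nonneg fun i _ => hg0 _) fun S => ?_
  have hsub : S ⊆ Fintype.piFinset fun i => S.image fun m => m i := fun m hm =>
    Fintype.mem_piFinset.mpr fun i => Finset.mem_image_of_mem _ hm
  refine (Finset.sum_le_sum_of_subset_of_nonneg hsub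
    fun m _ _ => Finset.prod_nonneg fun i _ => hg0 _).trans ?_
  rw [← Finset.prod_univ_sum]
  exact Finset.prod_le_prod (fun i _ => Finset.sum_nonneg fun n _ => hg0 n)
    fun i _ => hg.sum_le_tsum _ fun n _ => hg0 n

/-- The Fourier coefficients of a symbol decay rapidly, uniformly in `ξ`. -/
theorem exists_summable_bound (a : TestSymbol d) :
    ∃ s : (Fin d → ℤ) → ℝ, Summable s ∧ (∀ m, 0 ≤ s m) ∧ ∀ m ξ, ‖weylCoeff a m ξ‖ ≤ s m := by
  obtain ⟨C₀, hC₀⟩ := exists_norm_weylCoeff_le a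
  choose C hC using fun i => exists_abs_pow_mul_norm_weylCoeff_le i (2 * d) a
  have hC₀' : 0 ≤ C₀ := (norm_nonneg _).trans (hC₀ 0 0)
  have hC' : ∀ i, 0 ≤ C i := fun i => (by positivity : (0 : ℝ) ≤ _).trans (hC i 0 0)
  have hg0 : ∀ n : ℤ, (0 : ℝ) ≤ (1 + (n : ℝ) ^ 2)⁻¹ := fun n => by positivity
  have hg : Summable fun n : ℤ => (1 + (n : ℝ) ^ 2)⁻¹ := by
    refine Summable.of_norm_bounded_eventually
      (Real.summable_one_div_int_pow.mpr (le_refl 2)) ?_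
    filter_upwards [(Set.finite_singleton (0 : ℤ)).compl_mem_cofinite] with n hn
    have hn' : (n : ℝ) ≠ 0 := by exact_mod_cast hn
    rw [Real.norm_of_nonneg (hg0 n), one_div]
    exact inv_anti₀ (by positivity) (by linarith)
  refine ⟨fun m => (2 ^ d * (C₀ + ∑ i, C i)) * ∏ i, (1 + (m i : ℝ) ^ 2)⁻¹,
    (summable_pi_prod hg hg0).mul_left _, fun m => ?_, fun m ξ => ?_⟩
  · exact mul_nonneg (mul_nonneg (by positivity) (add_nonneg hC₀' (Finset.sum_nonneg
      fun i _ => hC' i))) (Finset.prod_nonneg fun i _ => hg0 _)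
  · beta_reduce
    rw [Finset.prod_inv_distrib, ← div_eq_mul_inv,
      le_div_iff₀ (Finset.prod_pos fun i _ => by positivity)]
    -- The largest `|m_i|` controls every factor of the product.
    have key : ∃ M : ℝ, (∀ i, (m i : ℝ) ^ 2 ≤ M) ∧ 1 ≤ M ∧
        M ^ d * ‖weylCoeff a m ξ‖ ≤ C₀ + ∑ i, C i := by
      by_cases hsmall : ∀ i, (m i : ℝ) ^ 2 ≤ 1
      · refine ⟨1, hsmall, le_rfl, ?_⟩
        rw [one_pow, one_mul]
        linarith [hC₀ m ξ, Finset.sum_nonneg fun i (_ : i ∈ Finset.univ) => hC' i]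
      · push Not at hsmall
        obtain ⟨i₀, hi₀⟩ := hsmall
        obtain ⟨i, -, hi⟩ := Finset.exists_max_image Finset.univ (fun i => (m i : ℝ) ^ 2)
          ⟨i₀, Finset.mem_univ _⟩
        refine ⟨(m i : ℝ) ^ 2, fun j => hi j (Finset.mem_univ _),
          hi₀.le.trans (hi i₀ (Finset.mem_univ _)), ?_⟩
        have h1 := hC i m ξ
        rw [pow_mul, sq_abs] at h1
        have h2 := Finset.single_le_sum (f := C) (fun i _ => hC' i) (Finset.mem_univ i)
        linarith
    obtain ⟨M, hM, hM1, hM2⟩ := key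
    have h1 : ∏ i, (1 + (m i : ℝ) ^ 2) ≤ (2 * M) ^ d := by
      refine (Finset.prod_le_prod (fun i _ => by positivity)
        fun i _ => (by linarith [hM i] : 1 + (m i : ℝ) ^ 2 ≤ 2 * M)).trans ?_
      simp
    calc ‖weylCoeff a m ξ‖ * ∏ i, (1 + (m i : ℝ) ^ 2)
        ≤ ‖weylCoeff a m ξ‖ * (2 * M) ^ d := mul_le_mul_of_nonneg_left h1 (norm_nonneg _)
      _ = 2 ^ d * (M ^ d * ‖weylCoeff a m ξ‖) := by rw [mul_pow]; ring
      _ ≤ _ := mul_le_mul_of_nonneg_left hM2 (by positivity)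

theorem exists_radius_weylCoeff (a : TestSymbol d) :
    ∃ R, 0 < R ∧ ∀ m ξ, R < ‖ξ‖ → weylCoeff a m ξ = 0 := by
  obtain ⟨R, hR0, hR⟩ := a.exists_radius
  refine ⟨R, hR0, fun m ξ hξ => ?_⟩
  rw [weylCoeff_eq]
  simp [hR _ ξ hξ]

theorem uniformContinuous_weylCoeff (a : TestSymbol d) (m : Fin d → ℤ) :
    UniformContinuous (weylCoeff a m) := by
  obtain ⟨R, -, hR⟩ := exists_radius_weylCoeff a
  have hcont : Continuous (weylCoeff a m) := by
    have : weylCoeff a m = fun ξ => (((2 * Real.pi) ^ (-(d : ℝ)) : ℝ) : ℂ) *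
        ∫ x : Torus d, a (x, ξ) * character (-m) x := funext fun ξ => weylCoeff_eq a m ξ
    rw [this]
    refine continuous_const.mul ?_
    have h := continuous_parametric_integral_of_continuous (μ := (volume : Measure (Torus d)))
      (f := fun (ξ : Freq d) (x : Torus d) => a (x, ξ) * character (-m) x)
      ((continuous_symbol_mul_character a (-m)).comp continuous_swap)
      (s := Set.univ) isCompact_univ
    simpa using h
  refine hcont.uniformContinuous_of_tendsto_cocompact (x := 0) ?_
  refine tendsto_const_nhds.congr' ?_
  filter_upwards [(isCompact_closedBall (0 : Freq d) R).compl_mem_cocompact] with ξ hξ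
  refine (hR m ξ ?_).symm
  simpa using hξ

end Symbols

/-! ### The Wigner distribution as a form in the Fourier coefficients -/

section Wigner

variable {d : ℕ}

/-- The matrix of `Op_h(a)` in the Fourier basis: the entry of row `k + m` and column `k` is
`α_m(h(2k+m)/2)`. -/
def weylKernel (h : ℝ) (a : TestSymbol d) (p : (Fin d → ℤ) × (Fin d → ℤ)) : ℂ :=
  weylCoeff a p.1 ((h / 2) • latticePoint (p.2 + (p.2 + p.1)))

theorem latticePoint_add (k j : Fin d → ℤ) :
    latticePoint (k + j) = latticePoint k + latticePoint j := by
  ext i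
  simp [latticePoint]

theorem latticePoint_sub (k j : Fin d → ℤ) :
    latticePoint (k - j) = latticePoint k - latticePoint j := by
  ext i
  simp [latticePoint]

theorem abs_le_norm_latticePoint (k : Fin d → ℤ) (i : Fin d) :
    |(k i : ℝ)| ≤ ‖latticePoint k‖ := by
  simpa [latticePoint] using PiLp.norm_apply_le (latticePoint k) i

theorem finite_norm_latticePoint_le (ρ : ℝ) :
    {k : Fin d → ℤ | ‖latticePoint k‖ ≤ ρ}.Finite := by
  refine (Set.finite_Icc (fun _ : Fin d => -⌈ρ⌉) (fun _ => ⌈ρ⌉)).subset fun k hk => ?_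
  have h1 : ∀ i, |k i| ≤ ⌈ρ⌉ := fun i => by
    have := ((abs_le_norm_latticePoint k i).trans hk).trans (Int.le_ceil ρ)
    exact_mod_cast this
  exact ⟨fun i => (abs_le.mp (h1 i)).1, fun i => (abs_le.mp (h1 i)).2⟩

/-- For fixed `h` the matrix of `Op_h(a)` is absolutely summable: its entries decay away from the
diagonal, and only finitely many antidiagonals meet the support of `a`. -/
theorem summable_norm_weylKernel {h : ℝ} (hh : 0 < h) (a : TestSymbol d) :
    Summable fun p => ‖weylKernel h a p‖ := by
  obtain ⟨s, hs, hs0, hsa⟩ := exists_summable_bound a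
  obtain ⟨R, hR0, hR⟩ := exists_radius_weylCoeff a
  set F : Set (Fin d → ℤ) := {k | ‖latticePoint k‖ ≤ 2 * R / h} with hF
  have h1 : Summable fun q : (Fin d → ℤ) × (Fin d → ℤ) => s q.1 * F.indicator 1 q.2 :=
    hs.mul_of_nonneg (summable_of_hasFiniteSupport
      ((finite_norm_latticePoint_le (2 * R / h)).subset Set.support_indicator_subset)) hs0
      (Set.indicator_nonneg fun _ _ => zero_le_one)
  have hinj : Function.Injective fun p : (Fin d → ℤ) × (Fin d → ℤ) =>
      (p.1, p.2 + (p.2 + p.1)) := by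
    rintro ⟨m, k⟩ ⟨m', k'⟩ hp
    simp only [Prod.mk.injEq] at hp
    obtain ⟨rfl, hk⟩ := hp
    refine Prod.ext rfl (funext fun i => ?_)
    have := congrFun hk i
    simp only [Pi.add_apply] at this ⊢
    omega
  refine Summable.of_nonneg_of_le (fun p => norm_nonneg _) (fun p => ?_)
    (h1.comp_injective hinj)
  simp only [Function.comp_apply, weylKernel]
  by_cases hp : p.2 + (p.2 + p.1) ∈ F
  · rw [Set.indicator_of_mem hp, Pi.one_apply, mul_one]
    exact hsa _ _
  · rw [Set.indicator_of_notMem hp, hR, norm_zero, mul_zero]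
    rw [hF, Set.mem_ofPred_eq, not_le, div_lt_iff₀ hh] at hp
    rw [norm_smul, Real.norm_of_nonneg (by positivity)]
    linarith

theorem wigner_eq {h : ℝ} (hh : 0 < h) (a : TestSymbol d) (u : L2 d) :
    wigner h u a = diagForm (weylKernel h a) (coeff u) := by
  obtain ⟨s, hs, hs0, hsa⟩ := exists_summable_bound a
  set A : (Fin d → ℤ) → (Fin d → ℤ) → ℂ := fun k j =>
    weylCoeff a (j - k) ((h / 2) • latticePoint (k + j)) with hA
  have hAK : ∀ k m, A k (k + m) = weylKernel h a (m, k) := fun k m => by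
    simp only [hA, weylKernel, add_sub_cancel_left]
  have hnorm : ∀ j : Fin d → ℤ, ‖expo j‖ = 1 := (orthonormal_expo d).1
  have hcol : ∀ k, Summable fun j => ‖A k j • (expo j : L2 d)‖ := fun k => by
    refine Summable.of_nonneg_of_le (fun j => norm_nonneg _) (fun j => ?_)
      (hs.comp_injective (i := fun j => j - k) (sub_left_injective))
    rw [norm_smul, hnorm, mul_one]
    exact hsa _ _
  have hK : Summable fun q : (Fin d → ℤ) × (Fin d → ℤ) => ‖weylKernel h a (q.2, q.1)‖ :=
    (summable_norm_weylKernel hh a).prod_symm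
  have hcolnorm : ∀ k, ‖∑' j, A k j • (expo j : L2 d)‖ ≤ ∑' m, ‖weylKernel h a (m, k)‖ :=
    fun k => by
    refine (norm_tsum_le_tsum_norm (hcol k)).trans_eq ?_
    rw [← (Equiv.addLeft k).tsum_eq]
    refine tsum_congr fun m => ?_
    rw [norm_smul, hnorm, mul_one, Equiv.coe_addLeft, hAK]
  have hcle : ∀ k, ‖coeff u k‖ ≤ ‖u‖ := fun k => by
    have := norm_inner_le_norm (𝕜 := ℂ) (expo k) u
    rwa [hnorm, one_mul] at this
  have hout : Summable fun k => coeff u k • ∑' j, A k j • (expo j : L2 d) := by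
    refine Summable.of_norm_bounded (hK.prod.mul_left ‖u‖) fun k => ?_
    rw [norm_smul]
    exact mul_le_mul (hcle k) (hcolnorm k) (norm_nonneg _) (norm_nonneg _)
  have h1 : wigner h u a = ∑' k, ∑' j, (starRingEnd ℂ) (coeff u j) * coeff u k * A k j := by
    change innerSL ℂ u (∑' k, coeff u k • ∑' j, A k j • (expo j : L2 d)) = _
    rw [ContinuousLinearMap.map_tsum _ hout]
    refine tsum_congr fun k => ?_
    rw [map_smul, ContinuousLinearMap.map_tsum _ (hcol k).of_norm, smul_eq_mul, ← tsum_mul_left]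
    refine tsum_congr fun j => ?_
    rw [map_smul, innerSL_apply_apply, inner_expo_right, smul_eq_mul]
    ring
  have hform := (summable_diagForm (K := weylKernel h a) (summable_coeff_sq u) hs
    fun m k => hsa _ _).prod_symm
  rw [h1, diagForm, ← (Equiv.prodComm _ _).tsum_eq]
  simp only [Equiv.prodComm_apply]
  rw [hform.tsum_prod]
  refine tsum_congr fun k => ?_
  rw [← (Equiv.addLeft k).tsum_eq]
  refine tsum_congr fun m => ?_
  rw [Equiv.coe_addLeft, hAK]
  rfl

theorem exists_summable_bound_weylKernel (a : TestSymbol d) :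
    ∃ s : (Fin d → ℤ) → ℝ, Summable s ∧ (∀ m, 0 ≤ s m) ∧
      ∀ h m k, ‖weylKernel h a (m, k)‖ ≤ s m := by
  obtain ⟨s, hs, hs0, hsa⟩ := exists_summable_bound a
  exact ⟨s, hs, hs0, fun h m k => hsa _ _⟩

theorem integral_character (m : Fin d → ℤ) :
    ∫ x : Torus d, character m x =
      if m = 0 then (((2 * Real.pi) ^ (d : ℝ) : ℝ) : ℂ) else 0 := by
  simp only [character, ContinuousMap.coe_mk]
  rw [MeasureTheory.integral_fintype_prod_volume_eq_prod (fun i x => fourier (m i) x)]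
  simp only [integral_fourier]
  split_ifs with h
  · simp [h]
  · obtain ⟨i, hi⟩ := Function.ne_iff.mp h
    exact Finset.prod_eq_zero (Finset.mem_univ i) (if_neg hi)

/-- A smooth compactly supported function of `ξ`, seen as a symbol independent of `x`. -/
def freqSymbol (b : Freq d → ℝ) (hb : ContDiff ℝ ∞ b) (hb' : HasCompactSupport b) :
    TestSymbol d where
  toFun z := (b z.2 : ℂ)
  smooth' := Complex.ofRealCLM.contDiff.comp (hb.comp contDiff_snd)
  hasCompactSupport' := by
    refine HasCompactSupport.intro (isCompact_univ.prod hb'.isCompact) fun z hz => ?_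
    have hz' : z.2 ∉ tsupport b := by simpa using hz
    simp [image_eq_zero_of_notMem_tsupport hz']

/-- The quantization of a function of `ξ` alone is the corresponding Fourier multiplier. -/
theorem wigner_freqSymbol {h : ℝ} (hh : 0 < h) (b : Freq d → ℝ) (hb : ContDiff ℝ ∞ b)
    (hb' : HasCompactSupport b) (u : L2 d) :
    wigner h u (freqSymbol b hb hb') =
      ((∑' k, ‖coeff u k‖ ^ 2 * b (h • latticePoint k) : ℝ) : ℂ) := by
  have hα : ∀ m ξ, weylCoeff (freqSymbol b hb hb') m ξ = if m = 0 then (b ξ : ℂ) else 0 := by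
    intro m ξ
    rw [weylCoeff_eq]
    change _ * ∫ x : Torus d, (b ξ : ℂ) * character (-m) x = _
    rw [integral_const_mul, integral_character]
    simp only [neg_eq_zero]
    split_ifs with hm
    · rw [mul_comm (b ξ : ℂ), ← mul_assoc, ← Complex.ofReal_mul,
        ← Real.rpow_add Real.two_pi_pos]
      simp
    · simp
  obtain ⟨s, hs, hs0, hsa⟩ := exists_summable_bound_weylKernel (freqSymbol b hb hb')
  have hsum := summable_diagForm (summable_coeff_sq u) hs (hsa h)
  rw [wigner_eq hh, diagForm, hsum.tsum_prod, tsum_eq_single 0, Complex.ofReal_tsum]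
  · refine tsum_congr fun k => ?_
    have hk : (h / 2) • latticePoint (k + (k + 0)) = h • latticePoint k := by
      rw [add_zero, latticePoint_add, ← two_smul ℝ (latticePoint k), smul_smul]
      congr 1
      ring
    simp only [weylKernel, hα, if_true, add_zero] at hk ⊢
    rw [hk, mul_comm ((starRingEnd ℂ) _), Complex.mul_conj, Complex.normSq_eq_norm_sq]
    push_cast
    ring
  · intro m hm
    simp [weylKernel, hα, hm]

end Wigner

/-! ### Vague compactness of probability measures on `T^*𝕋^d` -/

section Compactness

variable {d : ℕ}

/-- The open embedding of `T^*𝕋^d` in the compact space obtained by compactifying the fibres to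
closed balls. -/
def compactify (z : Cotangent d) : Torus d × Metric.closedBall (0 : Freq d) 1 :=
  (z.1, Set.inclusion Metric.ball_subset_closedBall (Homeomorph.unitBall z.2))

theorem isOpenEmbedding_compactify : IsOpenEmbedding (compactify (d := d)) := by
  have h : IsOpenEmbedding
      (Set.inclusion (Metric.ball_subset_closedBall (x := (0 : Freq d)) (ε := 1))) := by
    refine ⟨.inclusion _, ?_⟩
    rw [Set.range_inclusion]
    exact Metric.isOpen_ball.preimage continuous_subtype_val
  exact IsOpenEmbedding.id.prodMap (h.comp Homeomorph.unitBall.isOpenEmbedding)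

theorem continuous_extend_zero_of_isOpenEmbedding {X Y : Type*} [TopologicalSpace X]
    [TopologicalSpace Y] [T2Space Y] {j : X → Y} (hj : IsOpenEmbedding j) {f : X → ℂ}
    (hf : Continuous f) (hf' : HasCompactSupport f) : Continuous (Function.extend j f 0) := by
  rw [continuous_iff_continuousAt]
  intro y
  by_cases hy : y ∈ j '' tsupport f
  · obtain ⟨x, -, rfl⟩ := hy
    rw [← hj.continuousAt_iff, show Function.extend j f 0 ∘ j = f from
      funext fun x => hj.injective.extend_apply _ _ _]
    exact hf.continuousAt
  · have hopen : (j '' tsupport f)ᶜ ∈ 𝓝 y :=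
      (hf'.isCompact.image hj.continuous).isClosed.isOpen_compl.mem_nhds hy
    refine ContinuousAt.congr (f := fun _ => (0 : ℂ)) continuousAt_const ?_
    filter_upwards [hopen] with z hz
    by_cases hzr : ∃ x, j x = z
    · obtain ⟨x, rfl⟩ := hzr
      rw [hj.injective.extend_apply]
      by_contra hne
      exact hz ⟨x, subset_tsupport _ (Ne.symm hne), rfl⟩
    · rw [Function.extend_apply' _ _ _ hzr, Pi.zero_apply]

/-- A sequence of probability measures on `T^*𝕋^d` has a vaguely convergent subsequence; mass may
escape to infinity in `ξ`. -/
theorem exists_subseq_vague_limit (M : ℕ → Measure (Cotangent d))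
    [∀ n, IsProbabilityMeasure (M n)] :
    ∃ ν : Measure (Cotangent d), IsFiniteMeasure ν ∧ ∃ φ : ℕ → ℕ, StrictMono φ ∧
      ∀ a : TestSymbol d, Tendsto (fun n => ∫ z, a z ∂(M (φ n))) atTop (𝓝 (∫ z, a z ∂ν)) := by
  have hj := isOpenEmbedding_compactify (d := d)
  have hjm : MeasurableEmbedding (compactify (d := d)) := hj.measurableEmbedding
  let P : ℕ → ProbabilityMeasure (Torus d × Metric.closedBall (0 : Freq d) 1) := fun n =>
    ⟨(M n).map compactify, Measure.isProbabilityMeasure_map hj.continuous.measurable.aemeasurable⟩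
  have : CompactSpace (Metric.closedBall (0 : Freq d) 1) :=
    isCompact_iff_compactSpace.mp (isCompact_closedBall 0 1)
  obtain ⟨P₀, -, φ, hφ, hlim⟩ := isCompact_univ.isSeqCompact (fun n => Set.mem_univ (P n))
  refine ⟨(P₀ : Measure _).comap compactify, ?_, φ, hφ, fun a => ?_⟩
  · exact ⟨(hjm.comap_apply _ _).trans_lt (measure_lt_top _ _)⟩
  set g := Function.extend (compactify (d := d)) a 0 with hg
  have hgc : Continuous g :=
    continuous_extend_zero_of_isOpenEmbedding hj a.continuous a.hasCompactSupport'
  have hgj : ∀ z, g (compactify z) = a z := fun z => hj.injective.extend_apply _ _ _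
  rw [ProbabilityMeasure.tendsto_iff_forall_integral_rclike_tendsto ℂ] at hlim
  have h1 := hlim (BoundedContinuousFunction.mkOfCompact ⟨g, hgc⟩)
  have h2 : ∀ n, ∫ z, g z ∂(P n : Measure _) = ∫ z, a z ∂(M n) := fun n => by
    change ∫ z, g z ∂((M n).map compactify) = _
    rw [hjm.integral_map]
    simp only [hgj]
  have h3 : ∫ z, g z ∂(P₀ : Measure _) = ∫ z, a z ∂((P₀ : Measure _).comap compactify) := by
    have h4 : ∫ z, g z ∂(((P₀ : Measure _).comap compactify).map compactify) =
        ∫ z, a z ∂((P₀ : Measure _).comap compactify) := by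
      rw [hjm.integral_map]
      simp only [hgj]
    rw [← h4, hjm.map_comap, setIntegral_eq_integral_of_forall_compl_eq_zero]
    intro z hz
    exact Function.extend_apply' _ _ _ hz
  simp only [BoundedContinuousFunction.mkOfCompact_apply, ContinuousMap.coe_mk,
    Function.comp_apply] at h1
  rw [← h3]
  simpa only [h2] using h1

end Compactness

/-! ### Positive approximations of Wigner distributions -/

section Husimi

variable {d : ℕ}

/-- The box `{0, …, N-1}^d` of frequencies. -/
def box (d N : ℕ) : Finset (Fin d → ℤ) := Fintype.piFinset fun _ => Finset.Ico (0 : ℤ) N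

theorem card_box (d N : ℕ) : (box d N).card = N ^ d := by
  simp [box]

/-- The part of the Fourier series of `u` with frequencies in the box `s + {0, …, N-1}^d`. -/
def blockSum (u : L2 d) (N : ℕ) (s : Fin d → ℤ) : C(Torus d, ℂ) :=
  ∑ q ∈ box d N, (coeff u (s + q) * (((2 * Real.pi) ^ (-(d : ℝ) / 2) : ℝ) : ℂ)) •
    character (s + q)

/-- The density in `x` of the Husimi measure on the fibre over `s`. -/
def husimiDensity (u : L2 d) (N : ℕ) (s : Fin d → ℤ) (x : Torus d) : ℝ :=
  ((N : ℝ) ^ d)⁻¹ * ‖blockSum u N s x‖ ^ 2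

/-- A Husimi-type measure of `u`: the energy densities of the blocks of `N^d` neighbouring
frequencies, each placed at the frequency `h s` of its corner `s ∈ ℤ^d`. It is positive by
construction, and close to the Wigner distribution when `N → ∞` and `h N → 0`. -/
def husimi (h : ℝ) (N : ℕ) (u : L2 d) : Measure (Cotangent d) :=
  Measure.sum fun s : Fin d → ℤ =>
    ((volume : Measure (Torus d)).withDensity
      fun x => ENNReal.ofReal (husimiDensity u N s x)).map fun x => (x, h • latticePoint s)

theorem continuous_husimiDensity (u : L2 d) (N : ℕ) (s : Fin d → ℤ) :
    Continuous (husimiDensity u N s) :=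
  continuous_const.mul ((blockSum u N s).continuous.norm.pow 2)

theorem husimiDensity_nonneg (u : L2 d) (N : ℕ) (s : Fin d → ℤ) (x : Torus d) :
    0 ≤ husimiDensity u N s x := by
  unfold husimiDensity
  positivity

theorem husimiDensity_eq (u : L2 d) (N : ℕ) (s : Fin d → ℤ) (x : Torus d) :
    (husimiDensity u N s x : ℂ) = ((N : ℂ) ^ d)⁻¹ * ∑ q ∈ box d N, ∑ q' ∈ box d N,
      (starRingEnd ℂ) (coeff u (s + q')) * coeff u (s + q) *
        ((((2 * Real.pi) ^ (-(d : ℝ)) : ℝ) : ℂ) * character (-(q' - q)) x) := by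
  have h1 : (((2 * Real.pi) ^ (-(d : ℝ)) : ℝ) : ℂ) =
      (((2 * Real.pi) ^ (-(d : ℝ) / 2) : ℝ) : ℂ) * (((2 * Real.pi) ^ (-(d : ℝ) / 2) : ℝ) : ℂ) := by
    rw [← Complex.ofReal_mul, ← Real.rpow_add Real.two_pi_pos]
    congr 2
    ring
  rw [husimiDensity]
  push_cast
  rw [← Complex.ofReal_pow, ← Complex.normSq_eq_norm_sq, ← Complex.mul_conj, h1, blockSum]
  simp only [ContinuousMap.sum_apply, ContinuousMap.smul_apply, map_sum, Finset.sum_mul_sum,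
    smul_eq_mul, map_mul, Complex.conj_ofReal]
  congr 1
  refine Finset.sum_congr rfl fun q _ => Finset.sum_congr rfl fun q' _ => ?_
  rw [show -(q' - q) = (s + q) + -(s + q') by abel,
    character_add (s + q) (-(s + q')), character_neg]
  ring

theorem integral_husimiDensity_mul (u : L2 d) (N : ℕ) (s : Fin d → ℤ) {g : Torus d → ℂ}
    (hg : Continuous g) :
    ∫ x, (husimiDensity u N s x : ℂ) * g x = ((N : ℂ) ^ d)⁻¹ * ∑ q ∈ box d N, ∑ q' ∈ box d N,
      (starRingEnd ℂ) (coeff u (s + q')) * coeff u (s + q) *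
        ((((2 * Real.pi) ^ (-(d : ℝ)) : ℝ) : ℂ) * ∫ x, g x * character (-(q' - q)) x) := by
  have hint : ∀ m : Fin d → ℤ, Integrable fun x : Torus d => g x * character m x := fun m =>
    (hg.mul (character m).continuous).integrable_of_hasCompactSupport
      (HasCompactSupport.of_compactSpace _)
  have h1 : ∀ x, (husimiDensity u N s x : ℂ) * g x = ((N : ℂ) ^ d)⁻¹ *
      ∑ q ∈ box d N, ∑ q' ∈ box d N, ((starRingEnd ℂ) (coeff u (s + q')) * coeff u (s + q) *
        (((2 * Real.pi) ^ (-(d : ℝ)) : ℝ) : ℂ)) * (g x * character (-(q' - q)) x) := fun x => by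
    rw [husimiDensity_eq, mul_assoc, Finset.sum_mul]
    congr 1
    refine Finset.sum_congr rfl fun q _ => ?_
    rw [Finset.sum_mul]
    refine Finset.sum_congr rfl fun q' _ => ?_
    ring
  simp only [h1]
  rw [integral_const_mul, integral_finsetSum _ fun q _ => integrable_finsetSum _ fun q' _ =>
    (hint _).const_mul _]
  congr 1
  refine Finset.sum_congr rfl fun q _ => ?_
  rw [integral_finsetSum _ fun q' _ => (hint _).const_mul _]
  refine Finset.sum_congr rfl fun q' _ => ?_
  rw [integral_const_mul]
  ring

theorem integral_husimiDensity (u : L2 d) (N : ℕ) (s : Fin d → ℤ) :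
    ∫ x, husimiDensity u N s x = ((N : ℝ) ^ d)⁻¹ * ∑ q ∈ box d N, ‖coeff u (s + q)‖ ^ 2 := by
  have h := integral_husimiDensity_mul u N s (g := fun _ => 1) continuous_const
  simp only [mul_one, one_mul, integral_character] at h
  have h2 : ∀ q ∈ box d N, ∑ q' ∈ box d N,
      (starRingEnd ℂ) (coeff u (s + q')) * coeff u (s + q) *
        ((((2 * Real.pi) ^ (-(d : ℝ)) : ℝ) : ℂ) *
          if -(q' - q) = 0 then (((2 * Real.pi) ^ (d : ℝ) : ℝ) : ℂ) else 0) =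
      ((‖coeff u (s + q)‖ ^ 2 : ℝ) : ℂ) := fun q hq => by
    rw [Finset.sum_eq_single_of_mem q hq]
    · rw [if_pos (by simp), ← Complex.ofReal_mul, ← Real.rpow_add Real.two_pi_pos,
        neg_add_cancel, Real.rpow_zero, Complex.ofReal_one, mul_one, mul_comm,
        Complex.mul_conj, Complex.normSq_eq_norm_sq]
    · intro q' _ hne
      rw [if_neg (by rw [neg_eq_zero, sub_eq_zero]; exact hne)]
      simp
  rw [Finset.sum_congr rfl h2] at h
  have h3 : ((∫ x, husimiDensity u N s x : ℝ) : ℂ) =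
      ((((N : ℝ) ^ d)⁻¹ * ∑ q ∈ box d N, ‖coeff u (s + q)‖ ^ 2 : ℝ) : ℂ) := by
    rw [← integral_complex_ofReal, h]
    push_cast
    ring
  exact_mod_cast h3

theorem hasSum_shifted_coeff_sq (u : L2 d) (q : Fin d → ℤ) :
    HasSum (fun s => ‖coeff u (s + q)‖ ^ 2) (‖u‖ ^ 2) :=
  ((Equiv.addRight q).hasSum_iff (f := fun k => ‖coeff u k‖ ^ 2)).mpr (hasSum_coeff_sq u)

theorem isProbabilityMeasure_husimi (h : ℝ) {N : ℕ} (hN : 0 < N) {u : L2 d} (hu : ‖u‖ = 1) :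
    IsProbabilityMeasure (husimi h N u) := by
  have hmeas : ∀ s : Fin d → ℤ, Measurable fun x : Torus d => (x, h • latticePoint s) :=
    fun s => by fun_prop
  have h1 : ∀ s : Fin d → ℤ, (((volume : Measure (Torus d)).withDensity
      fun x => ENNReal.ofReal (husimiDensity u N s x)).map
        fun x => (x, h • latticePoint s)) Set.univ =
      ENNReal.ofReal (((N : ℝ) ^ d)⁻¹ * ∑ q ∈ box d N, ‖coeff u (s + q)‖ ^ 2) := fun s => by
    rw [Measure.map_apply (hmeas s) MeasurableSet.univ, Set.preimage_univ,
      withDensity_apply _ MeasurableSet.univ, Measure.restrict_univ,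
      ← integral_husimiDensity, ofReal_integral_eq_lintegral_ofReal]
    · exact (continuous_husimiDensity u N s).integrable_of_hasCompactSupport
        (HasCompactSupport.of_compactSpace _)
    · exact Eventually.of_forall (husimiDensity_nonneg u N s)
  have h2 : HasSum (fun s : Fin d → ℤ => ((N : ℝ) ^ d)⁻¹ * ∑ q ∈ box d N, ‖coeff u (s + q)‖ ^ 2)
      1 := by
    have h3 := (hasSum_sum fun q (_ : q ∈ box d N) => hasSum_shifted_coeff_sq u q).mul_left
      (((N : ℝ) ^ d)⁻¹)
    have hN' : (N : ℝ) ≠ 0 := by exact_mod_cast hN.ne'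
    simpa [hu, card_box, hN'] using h3
  refine ⟨?_⟩
  rw [husimi, Measure.sum_apply _ MeasurableSet.univ]
  simp only [h1]
  rw [← ENNReal.ofReal_tsum_of_nonneg (fun s => by positivity) h2.summable, h2.tsum_eq,
    ENNReal.ofReal_one]

/-- The matrix of the quadratic form `u ↦ ∫ a` of the Husimi measures. -/
def husimiKernel (h : ℝ) (N : ℕ) (a : TestSymbol d) (p : (Fin d → ℤ) × (Fin d → ℤ)) : ℂ :=
  ((N : ℂ) ^ d)⁻¹ * ∑ q ∈ (box d N).filter fun q => q + p.1 ∈ box d N,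
    weylCoeff a p.1 (h • latticePoint (p.2 - q))

theorem norm_husimiKernel_le (h : ℝ) (N : ℕ) (a : TestSymbol d) {s : (Fin d → ℤ) → ℝ}
    (hs0 : ∀ m, 0 ≤ s m) (hs : ∀ m ξ, ‖weylCoeff a m ξ‖ ≤ s m) (m k : Fin d → ℤ) :
    ‖husimiKernel h N a (m, k)‖ ≤ s m := by
  rw [husimiKernel, norm_mul, norm_inv, norm_pow, Complex.norm_natCast]
  have h1 : ‖∑ q ∈ (box d N).filter fun q => q + m ∈ box d N,
      weylCoeff a m (h • latticePoint (k - q))‖ ≤ (N : ℝ) ^ d * s m := by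
    refine (norm_sum_le_of_le _ fun q _ => hs m _).trans ?_
    rw [Finset.sum_const, nsmul_eq_mul]
    refine mul_le_mul_of_nonneg_right ?_ (hs0 m)
    have := (Finset.card_filter_le (box d N) fun q => q + m ∈ box d N).trans_eq (card_box d N)
    exact_mod_cast this
  calc _ ≤ ((N : ℝ) ^ d)⁻¹ * ((N : ℝ) ^ d * s m) :=
        mul_le_mul_of_nonneg_left h1 (by positivity)
    _ = (((N : ℝ) ^ d)⁻¹ * (N : ℝ) ^ d) * s m := by ring
    _ ≤ s m := mul_le_of_le_one_left (hs0 m) (inv_mul_le_one)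

theorem summable_conj_mul (u : L2 d) (q q' : Fin d → ℤ) {g : (Fin d → ℤ) → ℂ} {C : ℝ}
    (hg : ∀ s, ‖g s‖ ≤ C) :
    Summable fun s => (starRingEnd ℂ) (coeff u (s + q')) * coeff u (s + q) * g s := by
  have h := (((hasSum_shifted_coeff_sq u q').summable.add
    (hasSum_shifted_coeff_sq u q).summable).mul_right C)
  refine Summable.of_norm_bounded h fun s => ?_
  rw [norm_mul, norm_mul, RCLike.norm_conj]
  have hC : 0 ≤ C := (norm_nonneg _).trans (hg s)
  refine mul_le_mul ?_ (hg s) (norm_nonneg _) (by positivity)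
  nlinarith [sq_nonneg (‖coeff u (s + q')‖ - ‖coeff u (s + q)‖),
    sq_nonneg ‖coeff u (s + q')‖, sq_nonneg ‖coeff u (s + q)‖]

theorem integral_husimi (h : ℝ) {N : ℕ} (hN : 0 < N) (a : TestSymbol d) {u : L2 d}
    (hu : ‖u‖ = 1) :
    ∫ z, a z ∂(husimi h N u) = diagForm (husimiKernel h N a) (coeff u) := by
  obtain ⟨s, hs, hs0, hsa⟩ := exists_summable_bound a
  have hprob := isProbabilityMeasure_husimi h hN hu
  obtain ⟨C, hC⟩ := a.exists_bound
  have hint : Integrable a (husimi h N u) :=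
    Integrable.of_bound a.continuous.aestronglyMeasurable C (Eventually.of_forall hC)
  have hfibre : ∀ t : Fin d → ℤ, ∫ z, a z ∂(((volume : Measure (Torus d)).withDensity
      fun x => ENNReal.ofReal (husimiDensity u N t x)).map fun x => (x, h • latticePoint t)) =
      ((N : ℂ) ^ d)⁻¹ * ∑ q ∈ box d N, ∑ q' ∈ box d N,
        (starRingEnd ℂ) (coeff u (t + q')) * coeff u (t + q) *
          weylCoeff a (q' - q) (h • latticePoint t) := fun t => by
    have hmap : Continuous fun x : Torus d => (x, h • latticePoint t) := by fun_prop
    rw [integral_map hmap.measurable.aemeasurable a.continuous.aestronglyMeasurable,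
      integral_withDensity_eq_integral_toReal_smul
        (continuous_husimiDensity u N t).measurable.ennreal_ofReal
        (Eventually.of_forall fun x => ENNReal.ofReal_lt_top)]
    simp only [ENNReal.toReal_ofReal (husimiDensity_nonneg u N t _), weylCoeff_eq]
    rw [← integral_husimiDensity_mul u N t (g := fun x => a (x, h • latticePoint t))
      (a.continuous.comp hmap)]
    simp only [Complex.real_smul]
  have hsum : ∀ q q', Summable fun t => (starRingEnd ℂ) (coeff u (t + q')) * coeff u (t + q) *
      weylCoeff a (q' - q) (h • latticePoint t) := fun q q' =>
    summable_conj_mul u q q' fun t => hsa (q' - q) _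
  have hleft : ∫ z, a z ∂(husimi h N u) = ((N : ℂ) ^ d)⁻¹ * ∑ q ∈ box d N, ∑ q' ∈ box d N,
      ∑' t, (starRingEnd ℂ) (coeff u (t + q')) * coeff u (t + q) *
        weylCoeff a (q' - q) (h • latticePoint t) := by
    rw [husimi, integral_sum_measure (by simpa only [husimi] using hint), tsum_congr hfibre,
      tsum_mul_left, Summable.tsum_finsetSum fun q _ => summable_sum fun q' _ => hsum q q']
    congr 1
    exact Finset.sum_congr rfl fun q _ => Summable.tsum_finsetSum fun q' _ => hsum q q'
  -- The contribution of a fixed position `q` in the box, with `m = q' - q` and `k = t + q`.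
  set K : (Fin d → ℤ) → (Fin d → ℤ) × (Fin d → ℤ) → ℂ := fun q p =>
    if q + p.1 ∈ box d N then weylCoeff a p.1 (h • latticePoint (p.2 - q)) else 0 with hK
  have hKs : ∀ q m k, ‖K q (m, k)‖ ≤ s m := fun q m k => by
    simp only [hK]
    split_ifs
    · exact hsa _ _
    · simpa using hs0 m
  have hq : ∀ q, diagForm (K q) (coeff u) = ∑ q' ∈ box d N,
      ∑' t, (starRingEnd ℂ) (coeff u (t + q')) * coeff u (t + q) *
        weylCoeff a (q' - q) (h • latticePoint t) := fun q => by
    rw [diagForm, (summable_diagForm (summable_coeff_sq u) hs (hKs q)).tsum_prod,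
      ← (Equiv.subRight q).tsum_eq, tsum_eq_sum (s := box d N)]
    · refine Finset.sum_congr rfl fun q' hq' => ?_
      rw [← (Equiv.addRight q).tsum_eq]
      refine tsum_congr fun t => ?_
      simp only [hK, Equiv.coe_addRight, Equiv.subRight_apply, add_sub_cancel, hq', if_true,
        add_sub_cancel_right, add_assoc]
    · intro q' hq'
      simp [hK, hq']
  have hker : husimiKernel h N a = fun p => ((N : ℂ) ^ d)⁻¹ * ∑ q ∈ box d N, K q p := by
    ext p
    rw [husimiKernel, Finset.sum_filter]
  rw [hleft, ← Finset.sum_congr rfl fun q _ => hq q, hker]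
  simp only [diagForm]
  rw [← Summable.tsum_finsetSum fun q _ => summable_diagForm (summable_coeff_sq u) hs (hKs q),
    ← tsum_mul_left]
  refine tsum_congr fun p => ?_
  rw [Finset.mul_sum, Finset.mul_sum, Finset.mul_sum]
  refine Finset.sum_congr rfl fun q _ => ?_
  ring

end Husimi

section HusimiLimit

variable {d : ℕ}

theorem tendsto_card_box_inter (m : Fin d → ℤ) :
    Tendsto (fun N : ℕ => ((N : ℝ) ^ d)⁻¹ *
      ((box d N).filter fun q => q + m ∈ box d N).card) atTop (𝓝 1) := by
  set c : ℕ → ℤ → ℕ := fun N n =>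
    ((Finset.Ico (0 : ℤ) N).filter fun x => x + n ∈ Finset.Ico (0 : ℤ) N).card with hc
  have hcard : ∀ N : ℕ, ((box d N).filter fun q => q + m ∈ box d N).card = ∏ i, c N (m i) := by
    intro N
    rw [hc, ← Fintype.card_piFinset]
    congr 1
    ext q
    simp only [box, Finset.mem_filter, Fintype.mem_piFinset, Pi.add_apply, forall_and]
  have hone : ∀ n : ℤ, Tendsto (fun N : ℕ => (N : ℝ)⁻¹ * c N n) atTop (𝓝 1) := by
    intro n
    have hlow : Tendsto (fun N : ℕ => 1 - |(n : ℝ)| * (N : ℝ)⁻¹) atTop (𝓝 1) := by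
      have := (tendsto_inv_atTop_nhds_zero_nat (𝕜 := ℝ)).const_mul |(n : ℝ)|
      simpa using this.const_sub 1
    refine tendsto_of_tendsto_of_tendsto_of_le_of_le' hlow tendsto_const_nhds ?_ ?_
    · filter_upwards [eventually_gt_atTop 0] with N hN
      have hN' : (0 : ℝ) < N := by exact_mod_cast hN
      have h1 : (N : ℤ) - |n| ≤ c N n := by
        have hsub : Finset.Ico (max 0 (-n)) (min (N : ℤ) (N - n)) ⊆
            (Finset.Ico (0 : ℤ) N).filter fun x => x + n ∈ Finset.Ico (0 : ℤ) N := by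
          intro x hx
          simp only [Finset.mem_Ico, Finset.mem_filter] at hx ⊢
          omega
        have h2 : _ ≤ c N n := Finset.card_le_card hsub
        rw [Int.card_Ico] at h2
        simp only [max_def, min_def] at h2
        rcases abs_cases n with ⟨hn, hn0⟩ | ⟨hn, hn0⟩ <;> split_ifs at h2 <;> omega
      have h2 : (N : ℝ) - |(n : ℝ)| ≤ c N n := by exact_mod_cast h1
      calc 1 - |(n : ℝ)| * (N : ℝ)⁻¹ = (N : ℝ)⁻¹ * (N - |(n : ℝ)|) := by field_simp
        _ ≤ _ := mul_le_mul_of_nonneg_left h2 (by positivity)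
    · refine Eventually.of_forall fun N => ?_
      have h1 : c N n ≤ N := by
        refine (Finset.card_filter_le _ _).trans_eq ?_
        simp
      have h2 : (c N n : ℝ) ≤ N := by exact_mod_cast h1
      exact (mul_le_mul_of_nonneg_left h2 (by positivity)).trans inv_mul_le_one
  have h := tendsto_finsetProd Finset.univ fun i _ => hone (m i)
  simp only [Finset.prod_mul_distrib, Finset.prod_const, Finset.card_univ, Fintype.card_fin,
    one_pow] at h
  simpa only [hcard, Nat.cast_prod, inv_pow] using h

theorem norm_latticePoint_le_of_mem_box {N : ℕ} {q : Fin d → ℤ} (hq : q ∈ box d N) :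
    ‖latticePoint q‖ ≤ d * N := by
  rw [EuclideanSpace.norm_eq]
  refine Real.sqrt_le_iff.mpr ⟨by positivity, ?_⟩
  have h1 : ∀ i, ‖latticePoint q i‖ ^ 2 ≤ (N : ℝ) ^ 2 := fun i => by
    have h2 := Finset.mem_Ico.mp (Fintype.mem_piFinset.mp hq i)
    have h3 : (0 : ℝ) ≤ q i := by exact_mod_cast h2.1
    have h4 : (q i : ℝ) ≤ N := by exact_mod_cast h2.2.le
    have h5 : latticePoint q i = q i := rfl
    rw [h5, Real.norm_eq_abs, sq_abs]
    exact pow_le_pow_left₀ h3 h4 2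
  refine (Finset.sum_le_sum fun i _ => h1 i).trans ?_
  rw [Finset.sum_const, Finset.card_univ, Fintype.card_fin, nsmul_eq_mul, mul_pow]
  have h2 : (d : ℝ) ≤ (d : ℝ) ^ 2 := by exact_mod_cast Nat.le_self_pow (by norm_num) d
  exact mul_le_mul_of_nonneg_right h2 (by positivity)

/-- The Husimi measures with blocks of side `N_n`, where `N_n → ∞` and `h_n N_n → 0`, are
asymptotic to the Wigner distributions: on each diagonal the Husimi kernel averages
`α_m` over points at distance `O(h N)`, over a proportion of the box tending to `1`. -/
theorem tendsto_wigner_sub_husimi {h : ℕ → ℝ} {u : ℕ → L2 d} (hu : IsNormalisedSequence h u)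
    {N : ℕ → ℕ} (hN0 : ∀ n, 0 < N n) (hN : Tendsto N atTop atTop)
    (hhN : Tendsto (fun n => h n * N n) atTop (𝓝 0)) (a : TestSymbol d) :
    Tendsto (fun n => wigner (h n) (u n) a - ∫ z, a z ∂(husimi (h n) (N n) (u n)))
      atTop (𝓝 0) := by
  obtain ⟨s, hs, hs0, hsa⟩ := exists_summable_bound a
  have hc : ∀ n, Summable fun k => ‖coeff (u n) k‖ ^ 2 := fun n => summable_coeff_sq _
  have hc1 : ∀ n, ∑' k, ‖coeff (u n) k‖ ^ 2 ≤ 1 := fun n => by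
    rw [(hasSum_coeff_sq (u n)).tsum_eq, hu.norm_eq_one, one_pow]
  have hW : ∀ n m k, ‖weylKernel (h n) a (m, k)‖ ≤ s m := fun n m k => hsa _ _
  have hM : ∀ n m k, ‖husimiKernel (h n) (N n) a (m, k)‖ ≤ s m := fun n =>
    norm_husimiKernel_le (h n) (N n) a hs0 hsa
  have hform : ∀ n, wigner (h n) (u n) a - ∫ z, a z ∂(husimi (h n) (N n) (u n)) =
      diagForm (fun p => weylKernel (h n) a p - husimiKernel (h n) (N n) a p) (coeff (u n)) :=
    fun n => by
    rw [wigner_eq (hu.pos n), integral_husimi _ (hN0 n) _ (hu.norm_eq_one n),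
      diagForm_sub (hc n) hs (hW n) hs (hM n)]
  simp only [hform]
  refine tendsto_diagForm_zero hc hc1 (s := fun m => s m + s m) (hs.add hs)
    (fun n m k => (norm_sub_le _ _).trans (add_le_add (hW n m k) (hM n m k))) fun m => ?_
  refine tendsto_diagonal_zero_of_unif
    (K := fun n p => weylKernel (h n) a p - husimiKernel (h n) (N n) a p) hc hc1 m fun ε hε => ?_
  obtain ⟨δ, hδ, hcont⟩ := Metric.uniformContinuous_iff.mp (uniformContinuous_weylCoeff a m)
    (ε / 2) (half_pos hε)
  have hdist : Tendsto (fun n => h n * (‖latticePoint m‖ / 2) + d * (h n * N n)) atTop (𝓝 0) := by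
    simpa using (hu.tendsto_zero.mul_const (‖latticePoint m‖ / 2)).add (hhN.const_mul (d : ℝ))
  have hcard : Tendsto (fun n => (1 - (((N n : ℕ) : ℝ) ^ d)⁻¹ *
      ((box d (N n)).filter fun q => q + m ∈ box d (N n)).card) * s m) atTop (𝓝 0) := by
    simpa using (((tendsto_card_box_inter m).comp hN).const_sub 1).mul_const (s m)
  filter_upwards [hdist.eventually_lt_const hδ, hcard.eventually_lt_const (half_pos hε)]
    with n hn1 hn2 k
  set B := (box d (N n)).filter fun q => q + m ∈ box d (N n) with hB
  set κ : ℝ := (((N n : ℕ) : ℝ) ^ d)⁻¹ with hκ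
  have hNd : (0 : ℝ) < ((N n : ℕ) : ℝ) ^ d := by
    have : (0 : ℝ) < N n := by exact_mod_cast hN0 n
    positivity
  have hκ0 : 0 < κ := inv_pos.mpr hNd
  have hBle : κ * B.card ≤ 1 := by
    have h1 : (B.card : ℝ) ≤ ((N n : ℕ) : ℝ) ^ d := by
      have := (Finset.card_filter_le (box d (N n))
        fun q => q + m ∈ box d (N n)).trans_eq (card_box d (N n))
      exact_mod_cast this
    calc κ * B.card ≤ κ * ((N n : ℕ) : ℝ) ^ d := mul_le_mul_of_nonneg_left h1 hκ0.le
      _ = 1 := inv_mul_cancel₀ hNd.ne'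
  set w := weylKernel (h n) a (m, k) with hw
  have hsplit : w - husimiKernel (h n) (N n) a (m, k) =
      ((1 - κ * B.card : ℝ) : ℂ) * w +
        (κ : ℂ) * ∑ q ∈ B, (w - weylCoeff a m (h n • latticePoint (k - q))) := by
    rw [husimiKernel, Finset.sum_sub_distrib, Finset.sum_const, nsmul_eq_mul, ← hB, hκ]
    push_cast
    ring
  have hclose : ∀ q ∈ B, ‖w - weylCoeff a m (h n • latticePoint (k - q))‖ ≤ ε / 2 := by
    intro q hq
    rw [← dist_eq_norm]
    refine (hcont ?_).le
    have hqb := norm_latticePoint_le_of_mem_box (Finset.mem_filter.mp hq).1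
    have heq : (h n / 2) • latticePoint (k + (k + m)) - h n • latticePoint (k - q) =
        h n • ((1 / 2 : ℝ) • latticePoint m + latticePoint q) := by
      rw [latticePoint_add, latticePoint_add, latticePoint_sub]
      module
    rw [dist_eq_norm, heq, norm_smul, Real.norm_of_nonneg (hu.pos n).le]
    refine lt_of_le_of_lt ?_ hn1
    have h1 : ‖(1 / 2 : ℝ) • latticePoint m + latticePoint q‖ ≤
        ‖latticePoint m‖ / 2 + d * N n := by
      refine (norm_add_le _ _).trans (add_le_add ?_ hqb)
      rw [norm_smul, Real.norm_of_nonneg (by norm_num)]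
      linarith
    calc _ ≤ h n * (‖latticePoint m‖ / 2 + d * N n) :=
          mul_le_mul_of_nonneg_left h1 (hu.pos n).le
      _ = _ := by ring
  rw [hsplit]
  refine (norm_add_le _ _).trans ?_
  have h1 : ‖((1 - κ * B.card : ℝ) : ℂ) * w‖ ≤ ε / 2 := by
    rw [norm_mul, Complex.norm_real, Real.norm_of_nonneg (by linarith)]
    exact (mul_le_mul_of_nonneg_left (hW n m k) (by linarith)).trans hn2.le
  have h2 : ‖(κ : ℂ) * ∑ q ∈ B, (w - weylCoeff a m (h n • latticePoint (k - q)))‖ ≤ ε / 2 := by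
    rw [norm_mul, Complex.norm_real, Real.norm_of_nonneg hκ0.le]
    have h3 := norm_sum_le_of_le _ hclose
    rw [Finset.sum_const, nsmul_eq_mul] at h3
    calc _ ≤ κ * (B.card * (ε / 2)) := mul_le_mul_of_nonneg_left h3 hκ0.le
      _ = (κ * B.card) * (ε / 2) := by ring
      _ ≤ ε / 2 := mul_le_of_le_one_left (half_pos hε).le hBle
  linarith

/-- Every normalised sequence has a semiclassical measure. -/
theorem exists_isSemiclassicalMeasure {h : ℕ → ℝ} {u : ℕ → L2 d}
    (hu : IsNormalisedSequence h u) :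
    ∃ ν : Measure (Cotangent d), IsSemiclassicalMeasure h u ν := by
  set N : ℕ → ℕ := fun n => ⌈(Real.sqrt (h n))⁻¹⌉₊ with hNdef
  have hsq : ∀ n, 0 < Real.sqrt (h n) := fun n => Real.sqrt_pos.mpr (hu.pos n)
  have hsq0 : Tendsto (fun n => Real.sqrt (h n)) atTop (𝓝 0) := by
    simpa using hu.tendsto_zero.sqrt
  have hN0 : ∀ n, 0 < N n := fun n => Nat.ceil_pos.mpr (inv_pos.mpr (hsq n))
  have hN : Tendsto N atTop atTop :=
    tendsto_nat_ceil_atTop.comp (tendsto_inv_nhdsGT_zero.comp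
      (tendsto_nhdsWithin_iff.mpr ⟨hsq0, Eventually.of_forall hsq⟩))
  have hhN : Tendsto (fun n => h n * N n) atTop (𝓝 0) := by
    have hup : Tendsto (fun n => Real.sqrt (h n) + h n) atTop (𝓝 0) := by
      simpa using hsq0.add hu.tendsto_zero
    refine squeeze_zero (fun n => mul_nonneg (hu.pos n).le (Nat.cast_nonneg _)) (fun n => ?_) hup
    have h1 := (Nat.ceil_lt_add_one (inv_pos.mpr (hsq n)).le).le
    calc h n * N n ≤ h n * ((Real.sqrt (h n))⁻¹ + 1) :=
          mul_le_mul_of_nonneg_left h1 (hu.pos n).le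
      _ = Real.sqrt (h n) + h n := by
          rw [mul_add, mul_one, ← div_eq_mul_inv, Real.div_sqrt]
  have hprob : ∀ n, IsProbabilityMeasure (husimi (h n) (N n) (u n)) := fun n =>
    isProbabilityMeasure_husimi _ (hN0 n) (hu.norm_eq_one n)
  obtain ⟨ν, hν, φ, hφ, hlim⟩ :=
    exists_subseq_vague_limit fun n => husimi (h n) (N n) (u n)
  refine ⟨ν, inferInstance, φ, hφ, fun a => ?_⟩
  have h1 := ((tendsto_wigner_sub_husimi hu hN0 hN hhN a).comp hφ.tendsto_atTop).add (hlim a)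
  simpa using h1

end HusimiLimit

/-! ### Mass of the Fourier coefficients near a null set of frequencies -/

section Mass

variable {d : ℕ}

theorem exists_smooth_cutoff {F V : Set (Freq d)} (hF : IsCompact F) (hV : IsOpen V)
    (hFV : F ⊆ V) :
    ∃ b : Freq d → ℝ, ContDiff ℝ ∞ b ∧ HasCompactSupport b ∧ (∀ ξ, 0 ≤ b ξ) ∧ (∀ ξ, b ξ ≤ 1) ∧
      (∀ ξ ∈ F, b ξ = 1) ∧ ∀ ξ ∉ V, b ξ = 0 := by
  obtain ⟨K, hK, hFK, hKV⟩ := exists_compact_between hF hV hFV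
  obtain ⟨f, hf0, hf1, hf⟩ := exists_contMDiffMap_zero_one_of_isClosed (n := ⊤)
    (modelWithCornersSelf ℝ (Freq d)) (isOpen_interior (s := K)).isClosed_compl hF.isClosed
    (Set.disjoint_left.mpr fun x hx hxF => hx (hFK hxF))
  refine ⟨f, f.contMDiff.contDiff, ?_, fun ξ => (hf ξ).1, fun ξ => (hf ξ).2,
    fun ξ hξ => hf1 hξ, fun ξ hξ => hf0 fun hξK => hξ (hKV (interior_subset hξK))⟩
  exact HasCompactSupport.intro hK fun ξ hξ => hf0 fun hξK => hξ (interior_subset hξK)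

/-- If the Wigner distributions converge to `μ₀`, no mass of the Fourier coefficients is left on a
compact set of frequencies that is null for `μ₀`. -/
theorem tendsto_mass_zero {h : ℕ → ℝ} {u : ℕ → L2 d} (hu : IsNormalisedSequence h u)
    {μ₀ : Measure (Cotangent d)} [IsLocallyFiniteMeasure μ₀]
    (hlim : ∀ a : TestSymbol d, Tendsto (fun n => wigner (h n) (u n) a) atTop (𝓝 (∫ z, a z ∂μ₀)))
    {F : Set (Freq d)} (hF : IsCompact F) (hμF : μ₀ (Set.univ ×ˢ F) = 0) :
    Tendsto (fun n => ∑' k, ‖coeff (u n) k‖ ^ 2 * F.indicator 1 (h n • latticePoint k))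
      atTop (𝓝 (0 : ℝ)) := by
  have hind : ∀ ξ, 0 ≤ F.indicator (1 : Freq d → ℝ) ξ :=
    Set.indicator_nonneg fun _ _ => zero_le_one
  rw [Metric.tendsto_nhds]
  intro ε hε
  obtain ⟨W, hFW, hW, hWε⟩ := Set.exists_isOpen_lt_of_lt (Set.univ ×ˢ F : Set (Cotangent d))
    (μ := μ₀) (ENNReal.ofReal ε) (by rw [hμF]; exact ENNReal.ofReal_pos.mpr hε)
  obtain ⟨U, V, -, hV, hU, hFV, hUV⟩ := generalized_tube_lemma isCompact_univ hF hW hFW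
  obtain ⟨b, hb, hbc, hb0, hb1, hbF, hbV⟩ := exists_smooth_cutoff hF hV hFV
  have hbint : ∫ z : Cotangent d, b z.2 ∂μ₀ < ε := by
    have h1 : ∫ z : Cotangent d, b z.2 ∂μ₀ ≤ ∫ z, W.indicator 1 z ∂μ₀ := by
      refine integral_mono_of_nonneg (Eventually.of_forall fun z => hb0 _)
        ((integrable_indicator_iff hW.measurableSet).mpr
          (integrableOn_const (hWε.trans ENNReal.ofReal_lt_top).ne))
        (Eventually.of_forall fun z => ?_)
      by_cases hz : z.2 ∈ V
      · have hzW : z ∈ W := hUV ⟨hU (Set.mem_univ _), hz⟩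
        simpa [hzW] using hb1 z.2
      · simp only [hbV _ hz]
        exact Set.indicator_nonneg (fun _ _ => zero_le_one) z
    rw [integral_indicator_one hW.measurableSet] at h1
    refine h1.trans_lt ?_
    rw [measureReal_def]
    exact ENNReal.toReal_lt_of_lt_ofReal hWε
  have hconv := (Complex.continuous_re.tendsto _).comp (hlim (freqSymbol b hb hbc))
  have hre : (∫ z, (freqSymbol b hb hbc) z ∂μ₀).re = ∫ z : Cotangent d, b z.2 ∂μ₀ := by
    change (∫ z : Cotangent d, (b z.2 : ℂ) ∂μ₀).re = _
    rw [integral_complex_ofReal, Complex.ofReal_re]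
  rw [hre] at hconv
  filter_upwards [hconv.eventually_lt_const hbint] with n hn
  rw [Function.comp_apply, wigner_freqSymbol (hu.pos n), Complex.ofReal_re] at hn
  rw [Real.dist_0_eq_abs, abs_of_nonneg (tsum_nonneg fun k => mul_nonneg (sq_nonneg _) (hind _))]
  refine lt_of_le_of_lt ?_ hn
  have hc := summable_coeff_sq (u n)
  have hle : ∀ ξ, F.indicator (1 : Freq d → ℝ) ξ ≤ b ξ := fun ξ => by
    by_cases hξ : ξ ∈ F
    · simp [hξ, hbF ξ hξ]
    · simpa [hξ] using hb0 ξ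
  have hsb : Summable fun k => ‖coeff (u n) k‖ ^ 2 * b (h n • latticePoint k) :=
    Summable.of_nonneg_of_le (fun k => mul_nonneg (sq_nonneg _) (hb0 _))
      (fun k => mul_le_of_le_one_right (sq_nonneg _) (hb1 _)) hc
  exact Summable.tsum_le_tsum (fun k => mul_le_mul_of_nonneg_left (hle _) (sq_nonneg _))
    (Summable.of_nonneg_of_le (fun k => mul_nonneg (sq_nonneg _) (hind _))
      (fun k => mul_le_mul_of_nonneg_left (hle _) (sq_nonneg _)) hsb) hsb

end Mass

/-! ### Time averages -/

section TimeAverage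

variable {d : ℕ}

/-- The Fourier integral `∫ θ(t) e^{iλt} dt`. -/
def phaseAverage (θ : ℝ → ℂ) (l : ℝ) : ℂ := ∫ t : ℝ, θ t * Complex.exp (Complex.I * l * t)

theorem norm_exp_I_mul (l t : ℝ) : ‖Complex.exp (Complex.I * l * t)‖ = 1 := by
  rw [Complex.norm_exp]
  simp

theorem norm_phaseAverage_le (θ : ℝ → ℂ) (l : ℝ) : ‖phaseAverage θ l‖ ≤ ∫ t, ‖θ t‖ := by
  refine (norm_integral_le_integral_norm _).trans_eq ?_
  simp only [norm_mul, norm_exp_I_mul, mul_one]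

theorem phaseAverage_zero (θ : ℝ → ℂ) : phaseAverage θ 0 = ∫ t, θ t := by
  simp [phaseAverage]

theorem tendsto_phaseAverage (θ : ℝ → ℂ) : Tendsto (phaseAverage θ) (cocompact ℝ) (𝓝 0) := by
  have h := (Real.tendsto_integral_exp_smul_cocompact θ).comp
    (Homeomorph.mulRight₀ (-(2 * Real.pi)⁻¹ : ℝ)
      (neg_ne_zero.mpr (inv_ne_zero Real.two_pi_pos.ne'))).isClosedEmbedding.tendsto_cocompact
  refine h.congr fun l => ?_
  rw [Function.comp_apply, phaseAverage]
  congr 1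
  ext t
  rw [Circle.smul_def, smul_eq_mul, Real.fourierChar_apply, mul_comm]
  congr 2
  have : (Real.pi : ℂ) ≠ 0 := by exact_mod_cast Real.pi_ne_zero
  simp only [Homeomorph.coe_mulRight₀]
  push_cast
  field_simp

/-- Averaging the evolved Wigner distribution in time multiplies the matrix entries of `Op_h(a)`
by the Fourier integral of `θ` at the differences of eigenvalues. -/
theorem integral_wigner_propagator (H : Freq d → ℝ) {h : ℝ} (hh : 0 < h) (T : ℝ) (u : L2 d)
    (a : TestSymbol d) {θ : ℝ → ℂ} (hθ : Integrable θ) :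
    ∫ t : ℝ, θ t * wigner h (propagator H h (T * t) u) a =
      diagForm (fun p => weylKernel h a p * phaseAverage θ
        (T / h * (H (h • latticePoint (p.2 + p.1)) - H (h • latticePoint p.2)))) (coeff u) := by
  obtain ⟨s, hs, hs0, hsa⟩ := exists_summable_bound_weylKernel a
  set l : (Fin d → ℤ) × (Fin d → ℤ) → ℝ := fun p =>
    T / h * (H (h • latticePoint (p.2 + p.1)) - H (h • latticePoint p.2)) with hl
  set f : (Fin d → ℤ) × (Fin d → ℤ) → ℂ := fun p =>
    (starRingEnd ℂ) (coeff u (p.2 + p.1)) * coeff u p.2 * weylKernel h a p with hf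
  have hfs : Summable fun p => ‖f p‖ := by
    simpa only [hf, norm_diagForm_term] using
      summable_norm_diagForm (summable_coeff_sq u) hs (hsa h)
  have hw : ∀ t, θ t * wigner h (propagator H h (T * t) u) a =
      ∑' p, θ t * Complex.exp (Complex.I * l p * t) * f p := fun t => by
    rw [wigner_eq hh, diagForm, ← tsum_mul_left]
    refine tsum_congr fun p => ?_
    rw [coeff_propagator, coeff_propagator, map_mul, ← Complex.exp_conj]
    have h1 : Complex.exp (Complex.I * l p * t) =
        Complex.exp ((starRingEnd ℂ) (-Complex.I *
          ((T * t / h * H (h • latticePoint (p.2 + p.1)) : ℝ) : ℂ))) *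
        Complex.exp (-Complex.I * ((T * t / h * H (h • latticePoint p.2) : ℝ) : ℂ)) := by
      rw [← Complex.exp_add]
      congr 1
      rw [map_mul, map_neg, Complex.conj_I, Complex.conj_ofReal, hl]
      push_cast
      ring
    rw [h1]
    simp only [hf]
    ring
  have hint : ∀ p, Integrable fun t : ℝ => θ t * Complex.exp (Complex.I * l p * t) * f p :=
    fun p => by
    refine (hθ.mul_bdd (c := 1) (Continuous.aestronglyMeasurable (by fun_prop))
      (Eventually.of_forall fun t => (norm_exp_I_mul _ _).le)).mul_const _
  have hnorm : ∀ p, ∫ t : ℝ, ‖θ t * Complex.exp (Complex.I * l p * t) * f p‖ =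
      (∫ t, ‖θ t‖) * ‖f p‖ := fun p => by
    simp only [norm_mul, norm_exp_I_mul, mul_one]
    rw [integral_mul_const]
  have h2 := hasSum_integral_of_summable_integral_norm hint
    (by simpa only [hnorm] using hfs.mul_left _)
  simp only [hw]
  rw [← h2.tsum_eq, diagForm]
  refine tsum_congr fun p => ?_
  rw [integral_mul_const, phaseAverage]
  simp only [hf]
  ring

end TimeAverage

/-! ### Reduction to resonant pairs of frequencies in `O` -/

section Resonant

variable {d : ℕ}

open Classical in
/-- The part of the matrix of `Op_h(a)` that couples frequencies of `O` with the same energy. -/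
def resonantKernel (H : Freq d → ℝ) (O : Set (Freq d)) (h : ℝ) (a : TestSymbol d)
    (p : (Fin d → ℤ) × (Fin d → ℤ)) : ℂ :=
  if h • latticePoint p.2 ∈ O ∧ h • latticePoint (p.2 + p.1) ∈ O ∧
    H (h • latticePoint (p.2 + p.1)) = H (h • latticePoint p.2) then weylKernel h a p else 0

theorem norm_resonantKernel_le (H : Freq d → ℝ) (O : Set (Freq d)) (h : ℝ) (a : TestSymbol d)
    (p : (Fin d → ℤ) × (Fin d → ℤ)) : ‖resonantKernel H O h a p‖ ≤ ‖weylKernel h a p‖ := by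
  rw [resonantKernel]
  split_ifs
  · exact le_rfl
  · simp

/-- The entries of `Op_h(a)` vanish unless both frequencies lie within `O(h)` of the support. -/
theorem norm_le_of_weylKernel_ne_zero {a : TestSymbol d} {R : ℝ}
    (hR : ∀ m ξ, R < ‖ξ‖ → weylCoeff a m ξ = 0) {h : ℝ} (hh : 0 < h) {m k : Fin d → ℤ}
    (hm : h * ‖latticePoint m‖ ≤ 2) (hne : weylKernel h a (m, k) ≠ 0) :
    ‖h • latticePoint k‖ ≤ R + 1 ∧ ‖h • latticePoint (k + m)‖ ≤ R + 1 := by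
  have h1 : ‖(h / 2) • latticePoint (k + (k + m))‖ ≤ R := by
    by_contra hlt
    exact hne (hR _ _ (not_le.mp hlt))
  have h2 : ‖(h / 2) • latticePoint m‖ ≤ 1 := by
    rw [norm_smul, Real.norm_of_nonneg (by positivity)]
    linarith
  have e1 : h • latticePoint k =
      (h / 2) • latticePoint (k + (k + m)) - (h / 2) • latticePoint m := by
    simp only [latticePoint_add]
    module
  have e2 : h • latticePoint (k + m) =
      (h / 2) • latticePoint (k + (k + m)) + (h / 2) • latticePoint m := by
    simp only [latticePoint_add]
    module
  constructor
  · rw [e1]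
    exact (norm_sub_le _ _).trans (add_le_add h1 h2)
  · rw [e2]
    exact (norm_add_le _ _).trans (add_le_add h1 h2)

/-- At time scales beyond the spectral scale of `O`, the averages of the Wigner distributions are
asymptotic to those of the resonant part: a non-resonant pair of frequencies in `O` contributes a
value of the Fourier integral of `θ` far from the origin, small by the Riemann–Lebesgue lemma, and
pairs with a frequency outside `O` see only the mass that escapes from `O`. -/
theorem tendsto_timeAverage_sub_resonant (H : Freq d → ℝ) {O : Set (Freq d)} (hO : IsOpen O)
    {h : ℕ → ℝ} {u : ℕ → L2 d} (hu : IsNormalisedSequence h u) {T : ℕ → ℝ}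
    (hgap : ∀ C : ℝ, ∀ᶠ n in atTop, ∀ k j : Fin d → ℤ, h n • latticePoint k ∈ O →
      h n • latticePoint j ∈ O → H (h n • latticePoint k) ≠ H (h n • latticePoint j) →
      C ≤ |T n / h n * (H (h n • latticePoint k) - H (h n • latticePoint j))|)
    {μ₀ : Measure (Cotangent d)} [IsLocallyFiniteMeasure μ₀]
    (hlim : ∀ a : TestSymbol d, Tendsto (fun n => wigner (h n) (u n) a) atTop (𝓝 (∫ z, a z ∂μ₀)))
    (hμ₀ : μ₀ (Set.univ ×ˢ Oᶜ) = 0) {θ : ℝ → ℂ} (hθ : Integrable θ) (a : TestSymbol d) :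
    Tendsto (fun n => (∫ t : ℝ, θ t * wigner (h n) (propagator H (h n) (T n * t) (u n)) a) -
      (∫ t, θ t) * diagForm (resonantKernel H O (h n) a) (coeff (u n))) atTop (𝓝 0) := by
  obtain ⟨s, hs, hs0, hsa⟩ := exists_summable_bound_weylKernel a
  obtain ⟨R, hR0, hR⟩ := exists_radius_weylCoeff a
  set A : ℝ := ∫ t, ‖θ t‖ with hA
  have hA0 : 0 ≤ A := integral_nonneg fun t => norm_nonneg _
  have hc : ∀ n, Summable fun k => ‖coeff (u n) k‖ ^ 2 := fun n => summable_coeff_sq _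
  have hc1 : ∀ n, ∑' k, ‖coeff (u n) k‖ ^ 2 ≤ 1 := fun n => by
    rw [(hasSum_coeff_sq (u n)).tsum_eq, hu.norm_eq_one, one_pow]
  set l : ℕ → (Fin d → ℤ) × (Fin d → ℤ) → ℝ := fun n p => T n / h n *
    (H (h n • latticePoint (p.2 + p.1)) - H (h n • latticePoint p.2)) with hl
  set K₁ : ℕ → (Fin d → ℤ) × (Fin d → ℤ) → ℂ := fun n p =>
    weylKernel (h n) a p * phaseAverage θ (l n p) with hK₁
  set K₂ : ℕ → (Fin d → ℤ) × (Fin d → ℤ) → ℂ := fun n p =>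
    (∫ t, θ t) * resonantKernel H O (h n) a p with hK₂
  have hb₁ : ∀ n m k, ‖K₁ n (m, k)‖ ≤ A * s m := fun n m k => by
    simp only [hK₁]
    rw [norm_mul, mul_comm]
    exact mul_le_mul (norm_phaseAverage_le _ _) (hsa _ m k) (norm_nonneg _) hA0
  have hb₂ : ∀ n m k, ‖K₂ n (m, k)‖ ≤ A * s m := fun n m k => by
    simp only [hK₂]
    rw [norm_mul]
    exact mul_le_mul (norm_integral_le_integral_norm _)
      ((norm_resonantKernel_le _ _ _ _ _).trans (hsa _ m k)) (norm_nonneg _) hA0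
  have hform : ∀ n, (∫ t : ℝ, θ t * wigner (h n) (propagator H (h n) (T n * t) (u n)) a) -
      (∫ t, θ t) * diagForm (resonantKernel H O (h n) a) (coeff (u n)) =
      diagForm (fun p => K₁ n p - K₂ n p) (coeff (u n)) := fun n => by
    rw [diagForm_sub (hc n) (hs.mul_left A) (hb₁ n) (hs.mul_left A) (hb₂ n),
      integral_wigner_propagator H (hu.pos n) (T n) (u n) a hθ]
    congr 1
    rw [diagForm, diagForm, ← tsum_mul_left]
    refine tsum_congr fun p => ?_
    simp only [hK₂]
    ring
  simp only [hform]
  refine tendsto_diagForm_zero hc hc1 ((hs.mul_left A).add (hs.mul_left A))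
    (fun n m k => (norm_sub_le _ _).trans (add_le_add (hb₁ n m k) (hb₂ n m k))) fun m => ?_
  set F : Set (Freq d) := Metric.closedBall 0 (R + 1) ∩ Oᶜ with hF
  have hFc : IsCompact F := (isCompact_closedBall _ _).inter_right hO.isClosed_compl
  have hμF : μ₀ (Set.univ ×ˢ F) = 0 :=
    measure_mono_null (Set.prod_mono_right Set.inter_subset_right) hμ₀
  have hmass := tendsto_mass_zero hu hlim hFc hμF
  set χ : ℕ → (Fin d → ℤ) → ℝ := fun n k => F.indicator 1 (h n • latticePoint k) with hχ
  have hχ0 : ∀ n k, 0 ≤ χ n k := fun n k => Set.indicator_nonneg (fun _ _ => zero_le_one) _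
  have hχ1 : ∀ n k, χ n k ≤ 1 := fun n k => Set.indicator_le_self' (fun _ _ => zero_le_one) _
  rw [Metric.tendsto_nhds]
  intro ε hε
  -- `η` is chosen so that the bound `(8 A + 1) s_m η` obtained below is less than `ε`.
  obtain ⟨η, hη, hηε⟩ : ∃ η : ℝ, 0 < η ∧ (8 * A + 1) * s m * η < ε := by
    have hpos : 0 ≤ (8 * A + 1) * s m := mul_nonneg (by positivity) (hs0 m)
    refine ⟨ε / ((8 * A + 1) * s m + 1), by positivity, ?_⟩
    rw [mul_div_assoc', div_lt_iff₀ (by positivity)]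
    nlinarith
  obtain ⟨C, hC⟩ : ∃ C : ℝ, ∀ x : ℝ, C ≤ |x| → ‖phaseAverage θ x‖ ≤ η := by
    have h1 := (Metric.tendsto_nhds.mp (tendsto_phaseAverage θ)) η hη
    rw [← Metric.cobounded_eq_cocompact, ← comap_norm_atTop, Filter.eventually_comap] at h1
    obtain ⟨C, hC⟩ := eventually_atTop.mp h1
    refine ⟨C, fun x hx => ?_⟩
    have := hC |x| hx x rfl
    rw [dist_zero_right] at this
    exact this.le
  have hhm : Tendsto (fun n => h n * ‖latticePoint m‖) atTop (𝓝 0) := by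
    simpa using hu.tendsto_zero.mul_const ‖latticePoint m‖
  filter_upwards [hgap C, hmass.eventually_lt_const (show 0 < η ^ 2 by positivity),
    hhm.eventually_lt_const two_pos] with n hn1 hn2 hn3
  set c := coeff (u n) with hcdef
  have hker : ∀ k, ‖K₁ n (m, k) - K₂ n (m, k)‖ ≤
      2 * A * s m * (χ n k + χ n (k + m)) + η * s m := fun k => by
    have hbound : ‖K₁ n (m, k) - K₂ n (m, k)‖ ≤ 2 * A * s m := by
      refine (norm_sub_le _ _).trans ((add_le_add (hb₁ n m k) (hb₂ n m k)).trans_eq ?_)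
      ring
    have hηs : 0 ≤ η * s m := mul_nonneg hη.le (hs0 m)
    have hAs : 0 ≤ 2 * A * s m := mul_nonneg (by positivity) (hs0 m)
    by_cases hne : weylKernel (h n) a (m, k) = 0
    · have h2 : K₁ n (m, k) - K₂ n (m, k) = 0 := by
        simp [hK₁, hK₂, resonantKernel, hne]
      rw [h2, norm_zero]
      exact add_nonneg (mul_nonneg hAs (add_nonneg (hχ0 n k) (hχ0 n _))) hηs
    obtain ⟨hk, hkm⟩ := norm_le_of_weylKernel_ne_zero hR (hu.pos n) hn3.le hne
    by_cases hkO : h n • latticePoint k ∈ O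
    · by_cases hkmO : h n • latticePoint (k + m) ∈ O
      · have hsmall : ‖K₁ n (m, k) - K₂ n (m, k)‖ ≤ η * s m := by
          by_cases hE : H (h n • latticePoint (k + m)) = H (h n • latticePoint k)
          · have h2 : K₁ n (m, k) - K₂ n (m, k) = 0 := by
              simp only [hK₁, hK₂, resonantKernel, hl, hE, hkO, hkmO, and_self, if_true, sub_self,
                mul_zero, phaseAverage_zero]
              ring
            rw [h2, norm_zero]
            exact hηs
          · have h2 : K₂ n (m, k) = 0 := by
              simp only [hK₂, resonantKernel, hE, and_false, if_false, mul_zero]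
            rw [h2, sub_zero]
            simp only [hK₁]
            rw [norm_mul, mul_comm]
            exact mul_le_mul (hC _ (hn1 _ _ hkmO hkO hE)) (hsa _ m k) (norm_nonneg _) hη.le
        exact hsmall.trans (le_add_of_nonneg_left
          (mul_nonneg hAs (add_nonneg (hχ0 n k) (hχ0 n _))))
      · have h2 : χ n (k + m) = 1 := by
          have hmem : h n • latticePoint (k + m) ∈ F := ⟨by simpa using hkm, hkmO⟩
          exact Set.indicator_of_mem hmem 1
        rw [h2]
        nlinarith [mul_nonneg hAs (hχ0 n k)]
    · have h2 : χ n k = 1 := by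
        have hmem : h n • latticePoint k ∈ F := ⟨by simpa using hk, hkO⟩
        exact Set.indicator_of_mem hmem 1
      rw [h2]
      nlinarith [mul_nonneg hAs (hχ0 n (k + m))]
  have hχs : Summable fun k => ‖c k‖ ^ 2 * χ n k :=
    Summable.of_nonneg_of_le (fun k => mul_nonneg (sq_nonneg _) (hχ0 n k))
      (fun k => mul_le_of_le_one_right (sq_nonneg _) (hχ1 n k)) (hc n)
  have hshift : ∀ g : (Fin d → ℤ) → ℝ, Summable g → HasSum (fun k => g (k + m)) (∑' k, g k) :=
    fun g hg => ((Equiv.addRight m).hasSum_iff (f := g)).mpr hg.hasSum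
  -- Young's inequality `|c_{k+m}| |c_k| ≤ η |c_{k+m}|² + η⁻¹ |c_k|²` in the two boundary terms.
  have hterm : ∀ k, ‖c (k + m)‖ * ‖c k‖ * ‖K₁ n (m, k) - K₂ n (m, k)‖ ≤
      2 * A * s m * (η * ‖c (k + m)‖ ^ 2 + η⁻¹ * (‖c k‖ ^ 2 * χ n k) + (η * ‖c k‖ ^ 2 +
        η⁻¹ * (‖c (k + m)‖ ^ 2 * χ n (k + m)))) + η * s m * (‖c (k + m)‖ * ‖c k‖) := fun k => by
    have young : ∀ x y z : ℝ, 0 ≤ x → 0 ≤ y → 0 ≤ z → z ≤ 1 →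
        x * y * z ≤ η * x ^ 2 + η⁻¹ * (y ^ 2 * z) := fun x y z hx hy hz hz1 => by
      have h1 : x * y ≤ η * x ^ 2 + η⁻¹ * y ^ 2 := by
        have h2 : η * x ^ 2 + η⁻¹ * y ^ 2 - x * y =
            η⁻¹ * ((η * x - y / 2) ^ 2 + 3 / 4 * y ^ 2) := by
          field_simp
          ring
        have h3 : 0 ≤ η⁻¹ * ((η * x - y / 2) ^ 2 + 3 / 4 * y ^ 2) := by positivity
        linarith
      calc x * y * z ≤ (η * x ^ 2 + η⁻¹ * y ^ 2) * z := mul_le_mul_of_nonneg_right h1 hz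
        _ = η * x ^ 2 * z + η⁻¹ * (y ^ 2 * z) := by ring
        _ ≤ _ := by
          have : η * x ^ 2 * z ≤ η * x ^ 2 := mul_le_of_le_one_right (by positivity) hz1
          linarith
    have y1 := young ‖c (k + m)‖ ‖c k‖ (χ n k) (norm_nonneg _) (norm_nonneg _) (hχ0 n k) (hχ1 n k)
    have y2 := young ‖c k‖ ‖c (k + m)‖ (χ n (k + m)) (norm_nonneg _) (norm_nonneg _) (hχ0 n _)
      (hχ1 n _)
    have hAs : 0 ≤ 2 * A * s m := mul_nonneg (by positivity) (hs0 m)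
    have h1 := mul_le_mul_of_nonneg_left (hker k)
      (show 0 ≤ ‖c (k + m)‖ * ‖c k‖ by positivity)
    have h2 := mul_le_mul_of_nonneg_left (add_le_add y1 y2) hAs
    refine h1.trans ?_
    calc _ = 2 * A * s m * (‖c (k + m)‖ * ‖c k‖ * χ n k + ‖c k‖ * ‖c (k + m)‖ * χ n (k + m)) +
          η * s m * (‖c (k + m)‖ * ‖c k‖) := by ring
      _ ≤ _ := by linarith
  have hsum := (((((hshift _ (hc n)).mul_left η).add (hχs.hasSum.mul_left η⁻¹)).add
    (((hc n).hasSum.mul_left η).add ((hshift _ hχs).mul_left η⁻¹))).mul_left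
      (2 * A * s m)).add ((summable_shift_mul (hc n) m).hasSum.mul_left (η * s m))
  have hle := Summable.tsum_le_tsum hterm (Summable.of_nonneg_of_le
    (fun k => by positivity) hterm hsum.summable) hsum.summable
  rw [hsum.tsum_eq] at hle
  rw [Real.dist_0_eq_abs, abs_of_nonneg (tsum_nonneg fun k => by positivity)]
  refine hle.trans_lt (lt_of_le_of_lt ?_ hηε)
  have b1 : η * ∑' k, ‖c k‖ ^ 2 ≤ η := mul_le_of_le_one_right hη.le (hc1 n)
  have b2 : η⁻¹ * ∑' k, ‖c k‖ ^ 2 * χ n k ≤ η := by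
    calc _ ≤ η⁻¹ * η ^ 2 := mul_le_mul_of_nonneg_left hn2.le (by positivity)
      _ = η := by field_simp
  have b3 : ∑' k, ‖c (k + m)‖ * ‖c k‖ ≤ 1 := (tsum_shift_mul_le (hc n) m).trans (hc1 n)
  have hAs : 0 ≤ 2 * A * s m := mul_nonneg (by positivity) (hs0 m)
  have b4 := mul_le_mul_of_nonneg_left (add_le_add (add_le_add b1 b2) (add_le_add b1 b2)) hAs
  have b5 := mul_le_mul_of_nonneg_left b3 (mul_nonneg hη.le (hs0 m))
  linarith

end Resonant

/-! ### Decomposition of the resonant part over energy levels -/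

section Levels

variable {d : ℕ}

open Classical in
/-- The Fourier coefficients of the projection of `u` to the frequencies of `O` with energy `E`. -/
def levelCoeff (H : Freq d → ℝ) (O : Set (Freq d)) (h : ℝ) (u : L2 d) (E : ℝ)
    (k : Fin d → ℤ) : ℂ :=
  if h • latticePoint k ∈ O ∧ H (h • latticePoint k) = E then coeff u k else 0

theorem norm_levelCoeff_le (H : Freq d → ℝ) (O : Set (Freq d)) (h : ℝ) (u : L2 d) (E : ℝ)
    (k : Fin d → ℤ) : ‖levelCoeff H O h u E k‖ ≤ ‖coeff u k‖ := by
  rw [levelCoeff]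
  split_ifs
  · exact le_rfl
  · simp

theorem summable_levelCoeff_sq (H : Freq d → ℝ) (O : Set (Freq d)) (h : ℝ) (u : L2 d) (E : ℝ) :
    Summable fun k => ‖levelCoeff H O h u E k‖ ^ 2 :=
  Summable.of_nonneg_of_le (fun _ => sq_nonneg _)
    (fun k => pow_le_pow_left₀ (norm_nonneg _) (norm_levelCoeff_le H O h u E k) 2)
    (summable_coeff_sq u)

/-- The projection of `u` to the frequencies of `O` with energy `E`. -/
def levelPart (H : Freq d → ℝ) (O : Set (Freq d)) (h : ℝ) (u : L2 d) (E : ℝ) : L2 d :=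
  ofCoeff (levelCoeff H O h u E) (summable_levelCoeff_sq H O h u E)

theorem coeff_levelPart (H : Freq d → ℝ) (O : Set (Freq d)) (h : ℝ) (u : L2 d) (E : ℝ)
    (k : Fin d → ℤ) : coeff (levelPart H O h u E) k = levelCoeff H O h u E k :=
  coeff_ofCoeff _ _ k

theorem hasSum_wigner_levelPart (H : Freq d → ℝ) (O : Set (Freq d)) {h : ℝ} (hh : 0 < h)
    (u : L2 d) (a : TestSymbol d) :
    HasSum (fun E => wigner h (levelPart H O h u E) a)
      (diagForm (resonantKernel H O h a) (coeff u)) := by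
  obtain ⟨s, hs, hs0, hsa⟩ := exists_summable_bound_weylKernel a
  have hsum := summable_diagForm (K := resonantKernel H O h a) (summable_coeff_sq u) hs
    fun m k => (norm_resonantKernel_le H O h a _).trans (hsa h m k)
  have h1 := hsum.hasSum.tsum_fiberwise fun p => H (h • latticePoint p.2)
  have h2 : (fun E => wigner h (levelPart H O h u E) a) = fun E =>
      ∑' p : (fun p : (Fin d → ℤ) × (Fin d → ℤ) => H (h • latticePoint p.2)) ⁻¹' {E},
        (starRingEnd ℂ) (coeff u (p.1.2 + p.1.1)) * coeff u p.1.2 *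
          resonantKernel H O h a p.1 := by
    ext E
    rw [wigner_eq hh, diagForm, tsum_subtype ((fun p : (Fin d → ℤ) × (Fin d → ℤ) =>
      H (h • latticePoint p.2)) ⁻¹' {E}) fun p : (Fin d → ℤ) × (Fin d → ℤ) =>
        (starRingEnd ℂ) (coeff u (p.2 + p.1)) * coeff u p.2 * resonantKernel H O h a p]
    refine tsum_congr fun p => ?_
    rw [coeff_levelPart, coeff_levelPart, levelCoeff, levelCoeff]
    by_cases hE : H (h • latticePoint p.2) = E
    · rw [Set.indicator_of_mem (by exact hE), resonantKernel]
      by_cases h2 : h • latticePoint p.2 ∈ O <;>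
        by_cases h3 : h • latticePoint (p.2 + p.1) ∈ O <;>
          by_cases h4 : H (h • latticePoint (p.2 + p.1)) = E <;>
            simp [hE, h2, h3, h4]
    · rw [Set.indicator_of_notMem (by exact hE)]
      simp [hE]
  rw [h2]
  exact h1

/-- The masses of the energy levels add up to at most `‖u‖²`. -/
theorem exists_hasSum_norm_levelPart_sq (H : Freq d → ℝ) (O : Set (Freq d)) (h : ℝ) (u : L2 d) :
    ∃ r ≤ ‖u‖ ^ 2, HasSum (fun E => ‖levelPart H O h u E‖ ^ 2) r := by
  classical
  set g : (Fin d → ℤ) → ℝ := fun k =>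
    if h • latticePoint k ∈ O then ‖coeff u k‖ ^ 2 else 0 with hg
  have hgle : ∀ k, g k ≤ ‖coeff u k‖ ^ 2 := fun k => by
    simp only [hg]
    split_ifs
    · exact le_rfl
    · positivity
  have hg0 : ∀ k, 0 ≤ g k := fun k => by
    simp only [hg]
    split_ifs
    · positivity
    · exact le_rfl
  have hgs : Summable g := Summable.of_nonneg_of_le hg0 hgle (summable_coeff_sq u)
  refine ⟨∑' k, g k, ?_, ?_⟩
  · rw [← (hasSum_coeff_sq u).tsum_eq]
    exact hgs.tsum_le_tsum hgle (summable_coeff_sq u)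
  · have h1 := hgs.hasSum.tsum_fiberwise fun k => H (h • latticePoint k)
    have h2 : (fun E => ‖levelPart H O h u E‖ ^ 2) = fun E =>
        ∑' k : (fun k : Fin d → ℤ => H (h • latticePoint k)) ⁻¹' {E}, g k := by
      ext E
      rw [← (hasSum_coeff_sq (levelPart H O h u E)).tsum_eq,
        tsum_subtype ((fun k : Fin d → ℤ => H (h • latticePoint k)) ⁻¹' {E}) g]
      refine tsum_congr fun k => ?_
      rw [coeff_levelPart, levelCoeff]
      by_cases hE : H (h • latticePoint k) = E
      · rw [Set.indicator_of_mem (by exact hE)]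
        simp only [hg, hE, and_true]
        split_ifs <;> simp
      · rw [Set.indicator_of_notMem (by exact hE)]
        simp [hE]
    rw [h2]
    exact h1

theorem coeff_smul (r : ℂ) (u : L2 d) (k : Fin d → ℤ) : coeff (r • u) k = r * coeff u k :=
  inner_smul_right _ _ _

theorem wigner_smul {h : ℝ} (hh : 0 < h) (r : ℝ) (u : L2 d) (a : TestSymbol d) :
    wigner h ((r : ℂ) • u) a = (r : ℂ) ^ 2 * wigner h u a := by
  rw [wigner_eq hh, wigner_eq hh, diagForm, diagForm, ← tsum_mul_left]
  refine tsum_congr fun p => ?_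
  rw [coeff_smul, coeff_smul, map_mul, Complex.conj_ofReal]
  ring

theorem isNormalisedEigenfunction_levelPart {H : Freq d → ℝ} {O : Set (Freq d)} {h : ℝ}
    {u : L2 d} {E : ℝ} (hne : levelPart H O h u E ≠ 0) :
    IsNormalisedEigenfunction H h
      (((‖levelPart H O h u E‖⁻¹ : ℝ) : ℂ) • levelPart H O h u E) := by
  have hn : ‖levelPart H O h u E‖ ≠ 0 := norm_ne_zero_iff.mpr hne
  refine ⟨?_, E, fun k => ?_⟩
  · rw [norm_smul, Complex.norm_real, norm_inv, norm_norm, inv_mul_cancel₀ hn]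
  · rw [coeff_smul, coeff_levelPart, levelCoeff]
    split_ifs with hk
    · rw [hk.2]
    · simp

end Levels

/-! ### The spectral gap and escaping eigenfunctions -/

section Gap

variable {d : ℕ}

theorem spectralScale_eq_zero_of_dim_zero (H : Freq 0 → ℝ) (O : Set (Freq 0)) (h : ℝ) :
    spectralScale H O h = 0 := by
  have h1 : ∀ k j : Fin 0 → ℤ,
      ¬ H (h • latticePoint k) ≠ H (h • latticePoint j) := fun k j hne =>
    hne (by rw [Subsingleton.elim k j])
  simp only [spectralScale, mul_eq_zero, ENNReal.iSup_eq_zero]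
  exact Or.inr fun k j _ _ hne => absurd hne (h1 k j)

/-- Beyond the spectral scale, distinct energies in `O` are separated by much more than `h / τ`. -/
theorem eventually_gap {H : Freq d → ℝ} {O : Set (Freq d)} {τ : ℝ → ℝ}
    (hτ_pos : ∀ h : ℝ, 0 < h → 0 < τ h)
    (hτ : Tendsto (fun h => spectralScale H O h / ENNReal.ofReal (τ h)) (𝓝[>] 0) (𝓝 0))
    {h : ℕ → ℝ} (hpos : ∀ n, 0 < h n) (hh : Tendsto h atTop (𝓝 0)) (C : ℝ) :
    ∀ᶠ n in atTop, ∀ k j : Fin d → ℤ, h n • latticePoint k ∈ O →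
      h n • latticePoint j ∈ O → H (h n • latticePoint k) ≠ H (h n • latticePoint j) →
      C ≤ |τ (h n) / h n * (H (h n • latticePoint k) - H (h n • latticePoint j))| := by
  set B : ℝ := max C 1 with hB
  have hB0 : 0 < B := lt_of_lt_of_le one_pos (le_max_right _ _)
  have h1 := hτ.comp (tendsto_nhdsWithin_iff.mpr ⟨hh, Eventually.of_forall hpos⟩)
  filter_upwards [h1.eventually_lt_const (ENNReal.ofReal_pos.mpr (inv_pos.mpr hB0))]
    with n hn k j hk hj hne
  have hτn := hτ_pos _ (hpos n)
  set Δ := |H (h n • latticePoint k) - H (h n • latticePoint j)| with hΔ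
  have hΔ0 : 0 < Δ := abs_pos.mpr (sub_ne_zero.mpr hne)
  have h2 : ENNReal.ofReal (h n) * ENNReal.ofReal Δ⁻¹ ≤ spectralScale H O (h n) := by
    refine mul_le_mul_right ?_ _
    exact le_iSup_of_le k (le_iSup_of_le j (le_iSup_of_le hk (le_iSup_of_le hj
      (le_iSup_of_le hne le_rfl))))
  rw [Function.comp_apply, ENNReal.div_lt_iff (Or.inl (ENNReal.ofReal_pos.mpr hτn).ne')
    (Or.inl ENNReal.ofReal_ne_top)] at hn
  have h3 := h2.trans hn.le
  rw [← ENNReal.ofReal_mul (hpos n).le, ← ENNReal.ofReal_mul (inv_pos.mpr hB0).le,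
    ENNReal.ofReal_le_ofReal_iff (by positivity)] at h3
  rw [abs_mul, abs_of_pos (div_pos hτn (hpos n)), ← hΔ]
  refine (le_max_left C 1).trans ?_
  rw [← hB]
  have h4 : h n * B ≤ τ (h n) * Δ := by
    have h5 := mul_le_mul_of_nonneg_right h3 (mul_pos hB0 hΔ0).le
    have e1 : h n * Δ⁻¹ * (B * Δ) = h n * B := by field_simp
    have e2 : B⁻¹ * τ (h n) * (B * Δ) = τ (h n) * Δ := by field_simp
    rwa [e1, e2] at h5
  rw [div_mul_eq_mul_div, le_div_iff₀ (hpos n)]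
  linarith

theorem wigner_expo {h : ℝ} (hh : 0 < h) (k : Fin d → ℤ) (a : TestSymbol d) :
    wigner h (expo k) a = weylCoeff a 0 (h • latticePoint k) := by
  rw [wigner_eq hh, diagForm, tsum_eq_single (0, k)]
  · have hk : (h / 2) • latticePoint (k + (k + 0)) = h • latticePoint k := by
      rw [add_zero, latticePoint_add]
      module
    simp only [weylKernel, coeff_expo, hk]
    simp
  · rintro ⟨m, j⟩ hne
    by_cases hj : j = k
    · subst hj
      have hm : m ≠ 0 := fun hm => hne (by rw [hm])
      simp [coeff_expo, hm]
    · simp [coeff_expo, hj]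

/-- In positive dimension the exponentials whose frequency tends to infinity are eigenfunctions
that escape from every compact set, so that the zero measure is a limit of eigenfunctions. -/
theorem zero_mem_eigenMeasures (hd : d ≠ 0) (H : Freq d → ℝ) :
    (0 : Measure (Cotangent d)) ∈ eigenMeasures H := by
  set h : ℕ → ℝ := fun n => 1 / ((n : ℝ) + 1) with hh
  set κ : ℕ → Fin d → ℤ := fun n _ => ((n : ℤ) + 1) ^ 2 with hκ
  have hpos : ∀ n, 0 < h n := fun n => by positivity
  refine ⟨h, fun n => expo (κ n),
    ⟨hpos, tendsto_one_div_add_atTop_nhds_zero_nat, fun n => (orthonormal_expo d).1 _⟩,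
    fun n => ⟨(orthonormal_expo d).1 _, H (h n • latticePoint (κ n)), fun k => ?_⟩,
    inferInstance, id, strictMono_id, fun a => ?_⟩
  · rw [coeff_expo]
    split_ifs with hk
    · rw [hk]
    · simp
  · obtain ⟨R, -, hR⟩ := exists_radius_weylCoeff a
    rw [integral_zero_measure]
    refine tendsto_const_nhds.congr' ?_
    filter_upwards [tendsto_natCast_atTop_atTop.eventually_ge_atTop R] with n hn
    rw [id, wigner_expo (hpos n), hR]
    have h1 := abs_le_norm_latticePoint (κ n) ⟨0, Nat.pos_of_ne_zero hd⟩
    have h2 : |((κ n ⟨0, Nat.pos_of_ne_zero hd⟩ : ℤ) : ℝ)| = ((n : ℝ) + 1) ^ 2 := by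
      simp only [hκ]
      push_cast
      exact abs_of_nonneg (by positivity)
    rw [h2] at h1
    rw [norm_smul, Real.norm_of_nonneg (hpos n).le]
    calc R < (n : ℝ) + 1 := by linarith
      _ = h n * ((n : ℝ) + 1) ^ 2 := by
        simp only [hh]
        field_simp
      _ ≤ _ := mul_le_mul_of_nonneg_left h1 (hpos n).le

end Gap

/-! ### Separation from the convex hull -/

section Separation

variable {d : ℕ}

/-- The Wigner distribution of a state, seen as a constant function of time. -/
def stationaryPairing (h : ℝ) (v : L2 d) (p : {θ : ℝ → ℂ // Integrable θ} × TestSymbol d) : ℂ :=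
  (∫ t, p.1.1 t) * wigner h v p.2

theorem pairing_const (ν : Measure (Cotangent d))
    (p : {θ : ℝ → ℂ // Integrable θ} × TestSymbol d) :
    pairing (Kernel.const ℝ ν) p = (∫ t, p.1.1 t) * ∫ z, p.2 z ∂ν := by
  simp only [pairing, Kernel.const_apply]
  rw [integral_mul_const]

/-- A continuous functional takes on some normalised eigenfunction a value at least its value on
the resonant part of `u`, which is a sub-convex combination of eigenfunctions. -/
theorem exists_eigenfunction_ge (H : Freq d → ℝ) (O : Set (Freq d)) {h : ℝ} (hh : 0 < h)
    {u : L2 d} (hu : ‖u‖ = 1)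
    (f : StrongDual ℝ ({θ : ℝ → ℂ // Integrable θ} × TestSymbol d → ℂ)) {r : ℝ} (hr : 0 ≤ r)
    (hf : r < f fun p => (∫ t, p.1.1 t) * diagForm (resonantKernel H O h p.2) (coeff u)) :
    ∃ v, IsNormalisedEigenfunction H h v ∧ r ≤ f (stationaryPairing h v) := by
  by_contra! hcon
  obtain ⟨q, hq, hmass⟩ := exists_hasSum_norm_levelPart_sq H O h u
  rw [hu, one_pow] at hq
  have hsum : HasSum (fun E => stationaryPairing h (levelPart H O h u E))
      fun p => (∫ t, p.1.1 t) * diagForm (resonantKernel H O h p.2) (coeff u) :=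
    Pi.hasSum.mpr fun p => (hasSum_wigner_levelPart H O hh u p.2).mul_left _
  have hle : ∀ E, f (stationaryPairing h (levelPart H O h u E)) ≤
      ‖levelPart H O h u E‖ ^ 2 * r := fun E => by
    by_cases hne : levelPart H O h u E = 0
    · have h0 : stationaryPairing h (levelPart H O h u E) = 0 := by
        ext p
        have := wigner_smul hh 0 (levelPart H O h u E) p.2
        simp only [Complex.ofReal_zero, zero_smul, ne_eq, OfNat.ofNat_ne_zero,
          not_false_eq_true, zero_pow, zero_mul] at this
        rw [stationaryPairing, hne, this, mul_zero, Pi.zero_apply]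
      rw [h0, map_zero]
      positivity
    · set v := levelPart H O h u E with hv
      have hn : ‖v‖ ≠ 0 := norm_ne_zero_iff.mpr hne
      have h1 : stationaryPairing h v =
          ‖v‖ ^ 2 • stationaryPairing h (((‖v‖⁻¹ : ℝ) : ℂ) • v) := by
        ext p
        rw [Pi.smul_apply, stationaryPairing, stationaryPairing, wigner_smul hh,
          Complex.real_smul]
        have hn' : (‖v‖ : ℂ) ≠ 0 := by exact_mod_cast hn
        push_cast
        field_simp
      rw [h1, map_smul, smul_eq_mul]
      exact mul_le_mul_of_nonneg_left
        (hcon _ (isNormalisedEigenfunction_levelPart hne)).le (by positivity)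
  have h2 := hasSum_le hle (f.hasSum hsum) (hmass.mul_right r)
  have h3 : q * r ≤ r := mul_le_of_le_one_left hr hq
  linarith

end Separation

end TorusFlow

end

theorem propositionp (d : ℕ) (H : TorusFlow.Freq d → ℝ) (hH : ContDiff ℝ ∞ H)
    (O : Set (TorusFlow.Freq d)) (hO : IsOpen O)
    (hscale : Tendsto (TorusFlow.spectralScale H O) (𝓝[>] 0) (𝓝 ⊤))
    (τ : ℝ → ℝ) (hτ_pos : ∀ h : ℝ, 0 < h → 0 < τ h)
    (hτ : Tendsto (fun h => TorusFlow.spectralScale H O h / ENNReal.ofReal (τ h))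
      (𝓝[>] 0) (𝓝 0))
    (μ : Kernel ℝ (TorusFlow.Cotangent d)) (h : ℕ → ℝ) (u : ℕ → TorusFlow.L2 d)
    (hμ : TorusFlow.IsObtainedThrough H τ h u μ)
    (μ₀ : Measure (TorusFlow.Cotangent d))
    (hμ₀ : TorusFlow.IsSemiclassicalMeasure h u μ₀)
    (hμ₀O : μ₀ (Set.univ ×ˢ Oᶜ) = 0) :
    μ ∈ TorusFlow.closedConvHull (TorusFlow.eigenMeasures H) := by
  open TorusFlow in
  refine ⟨hμ.finite, ?_⟩
  -- For `d = 0` there is a single frequency, so the spectral scale is `0` instead of `∞`.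
  have hd : d ≠ 0 := by
    rintro rfl
    have h0 : spectralScale H O = fun _ => 0 :=
      funext fun h => spectralScale_eq_zero_of_dim_zero H O h
    rw [h0] at hscale
    exact ENNReal.zero_ne_top (tendsto_nhds_unique tendsto_const_nhds hscale)
  by_contra hnot
  obtain ⟨f, r, hfr, hrμ⟩ := geometric_hahn_banach_closed_point
    (convex_convexHull ℝ _).closure isClosed_closure hnot
  have hfν : ∀ ν ∈ eigenMeasures H, f (pairing (Kernel.const ℝ ν)) < r := fun ν hν =>
    hfr _ (subset_closure (subset_convexHull ℝ _ ⟨ν, hν, rfl⟩))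
  -- Positivity of `r` compensates for mass lost in `ξ`, which makes the combinations of
  -- eigenfunctions below have total weight less than `1`.
  have hr : 0 < r := by
    have h1 := hfν 0 (zero_mem_eigenMeasures hd H)
    have h2 : pairing (Kernel.const ℝ (0 : Measure (Cotangent d))) = 0 := by
      ext p
      rw [pairing_const, integral_zero_measure, mul_zero, Pi.zero_apply]
    rwa [h2, map_zero] at h1
  obtain ⟨hfin, ι, hι, hlim⟩ := hμ₀
  set h' : ℕ → ℝ := fun n => h (ι n) with hh'
  set u' : ℕ → L2 d := fun n => u (ι n) with hu'
  have hseq : IsNormalisedSequence h' u' :=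
    ⟨fun n => hμ.normalised.pos _, hμ.normalised.tendsto_zero.comp hι.tendsto_atTop,
      fun n => hμ.normalised.norm_eq_one _⟩
  have hX : Tendsto (fun n => fun p : {θ : ℝ → ℂ // Integrable θ} × TestSymbol d =>
      (∫ t, p.1.1 t) * diagForm (resonantKernel H O (h' n) p.2) (coeff (u' n)))
      atTop (𝓝 (pairing μ)) := by
    refine tendsto_pi_nhds.mpr fun p => ?_
    have h1 := tendsto_timeAverage_sub_resonant H hO hseq (T := fun n => τ (h' n))
      (eventually_gap hτ_pos hτ hseq.pos hseq.tendsto_zero) hlim hμ₀O p.1.2 p.2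
    have h2 := ((hμ.tendsto p).comp hι.tendsto_atTop).sub h1
    simpa [hh', hu'] using h2
  obtain ⟨r', hrr', hr'μ⟩ := exists_between hrμ
  have hev := ((f.continuous.tendsto _).comp hX).eventually_const_lt hr'μ
  obtain ⟨n₀, hn₀⟩ := eventually_atTop.mp hev
  have hex : ∀ n, ∃ v, IsNormalisedEigenfunction H (h' (n + n₀)) v ∧
      r' ≤ f (stationaryPairing (h' (n + n₀)) v) := fun n =>
    exists_eigenfunction_ge H O (hseq.pos _) (hseq.norm_eq_one _) f (hr.trans hrr').le
      (hn₀ (n + n₀) (Nat.le_add_left _ _))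
  choose v hv hvr using hex
  have hvseq : IsNormalisedSequence (fun n => h' (n + n₀)) v :=
    ⟨fun n => hseq.pos _, hseq.tendsto_zero.comp (tendsto_add_atTop_nat n₀), fun n => (hv n).1⟩
  obtain ⟨ν, hν⟩ := exists_isSemiclassicalMeasure hvseq
  have hνmem : ν ∈ eigenMeasures H := ⟨_, v, hvseq, hv, hν⟩
  obtain ⟨-, φ, -, hφ⟩ := hν
  have hY : Tendsto (fun n => stationaryPairing (h' (φ n + n₀)) (v (φ n))) atTop
      (𝓝 (pairing (Kernel.const ℝ ν))) := by
    refine tendsto_pi_nhds.mpr fun p => ?_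
    rw [pairing_const]
    exact (hφ p.2).const_mul _
  have h3 : r' ≤ f (pairing (Kernel.const ℝ ν)) :=
    ge_of_tendsto' ((f.continuous.tendsto _).comp hY) fun n => hvr (φ n)
  exact absurd (hfν ν hνmem) (not_lt.mpr (hrr'.le.trans h3))
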